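/- Consider the periodic-review inventory problem with backorders and noisy observations $$x_{t+1}=x_t+a_t-D_t,\qquad y_t=x_t+\eta_t,\qquad t=0,1,\dots,$$ where $x_0\sim\mathcal N(\bar x_0,\sigma_{x_0}^2)$, $D_t\sim\mathcal N(\bar D,\sigma_D^2)$ and $\eta_t\sim\mathcal N(0,\sigma_\eta^2)$ are independent (variances $\ge 0$), and where the order $a_t\ge 0$ is chosen on the basis of the history $h_t=(y_0,a_0,\dots,y_{t-1},a_{t-1},y_t)$, possibly at random. Policies are sequences of stochastic kernels from histories to $[0,\infty)$. The one-stage cost is $c(x,a)=\hat c(a)+\mathsf E\,h(x+a-D)$ with $D\sim\mathcal N(\bar D,\sigma_D^2)$ and $\hat c(a)=K\mathbf 1_{\{a>0\}}+\tilde c a$, $K,\tilde c\ge 0$, and a policy is optimal for the horizon $T$ if it minimizes the expected total discounted cost $\mathsf E^\pi\sum_{t=0}^{T-1}\alpha^t c(x_t,a_t)\in[0,\infty]$ over all policies, where $\alpha\in[0,1)$. With the convention $0/0=0$ put $\sigma_0^2=\frac{\sigma_{x_0}^2\sigma_\eta^2}{\sigma_{x_0}^2+\sigma_\eta^2}$,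 $\sigma_{t+1}^2=\frac{(\sigma_t^2+\sigma_D^2)\sigma_\eta^2}{\sigma_t^2+\sigma_D^2+\sigma_\eta^2}$, and let $$\bar X_0=\bar x_0+\tfrac{\sigma_{x_0}^2}{\sigma_{x_0}^2+\sigma_\eta^2}(y_0-\bar x_0),\qquad \bar X_{t+1}=m_t+\tfrac{\sigma_t^2+\sigma_D^2}{\sigma_t^2+\sigma_D^2+\sigma_\eta^2}(y_{t+1}-m_t),\quad m_t=\bar X_t+a_t-\bar D,$$ which are functions of the history. Let $D_t^*\sim\mathcal N\bigl(\bar D,\frac{(\sigma_t^2+\sigma_D^2)^2}{\sigma_t^2+\sigma_D^2+\sigma_\eta^2}\bigr)$ be independent and let $h_t^*(x)=\mathsf E\,h(x+Z_t)$ with $Z_t\sim\mathcal N(0,\sigma_{t+1}^2)$. The mean-belief MDP is the completely observed inventory problem with states $\bar x_{t+1}=\bar x_t+a_t-D_t^*$, actions $a_t\ge0$, one-stage costs $c_t^*(\bar x,a)=\hat c(a)+\mathsf E\,h_t^*(\bar x+a-D_t^*)$ and discount factor $\alpha$. Let $h:\mathbb R\to[0,\infty)$ be convex with $h(x)\to\infty$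 as $|x|\to\infty$, let $\mathsf E\,h_t^*(y-D_t^*)<\infty$ for all $y\in\mathbb R$ and $t\ge0$, and suppose that $h$ satisfies the Veinott–Wagner condition: there are $z<y$ with $\frac{h(y)-h(z)}{y-z}<-\tilde c$. Then: 1. For every $t$ the function $h_t^*$ is finite and satisfies the Veinott–Wagner condition: there are $z_t<y_t$ with $\frac{h_t^*(y_t)-h_t^*(z_t)}{y_t-z_t}<-\tilde c$. 2. Under every policy, the conditional distribution of $x_t$ given $h_t$ is $\mathcal N(\bar X_t,\sigma_t^2)$, and $\mathsf E\,c(\xi,a)=c_t^*(\bar x,a)$ for $\xi\sim\mathcal N(\bar x,\sigma_t^2)$, for all $t$, $\bar x$ and $a\ge0$. 3. For every finite horizon $T$ there are numbers $s_t\le S_t$, $t=0,1,\dots$, with $s_t<S_t$ for all $t$ if $K>0$, such that the $(s_t,S_t)$-policy "order up to $S_t$ if $\bar x_t<s_t$, and do not order if $\bar x_t\ge s_t$" is optimal for the mean-belief MDP for every initial state, among all (randomized, history-dependent) policies, and such that the policy "order $S_t-\bar X_t$ if $\bar X_t<s_t$, and do not order if $\bar X_t\ge s_t$" is optimal for the original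 partially observable problem. -/

import Mathlib

open MeasureTheory ProbabilityTheory Filter Topology
open scoped NNReal ENNReal

noncomputable section

/-- What the decision maker has seen when choosing the action of period `t`: the pairs
`(y_0, a_0), …, (y_{t-1}, a_{t-1})` of past observations and actions, and the current observation
`y_t`.  In a completely observed problem the observations are the states. -/
abbrev Hist (t : ℕ) : Type := (Fin t → ℝ × ℝ≥0) × ℝ

/-- A (randomized, history-dependent) policy: for every period a stochastic kernel from histories
to order quantities. -/
structure Policy where
  rule : ∀ t : ℕ, Kernel (Hist t) ℝ≥0
  markov : ∀ t : ℕ, IsMarkovKernel (rule t)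

instance (π : Policy) (t : ℕ) : IsMarkovKernel (π.rule t) := π.markov t

/-- The nonrandomized policy with decision rules `φ t`. -/
def Policy.ofFun (φ : ∀ t : ℕ, Hist t → ℝ≥0) (hφ : ∀ t, Measurable (φ t)) : Policy where
  rule t := Kernel.deterministic (φ t) (hφ t)
  markov _ := inferInstance

/-- The order quantity of the `(s, S)` rule: order up to `S` below `s`, otherwise do not order. -/
def ssOrder (s S x : ℝ) : ℝ≥0 := if x < s then (S - x).toNNReal else 0

theorem measurable_ssOrder (s S : ℝ) : Measurable (ssOrder s S) := by
  unfold ssOrder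
  exact Measurable.ite measurableSet_Iio (by fun_prop) measurable_const

/-- The Veinott–Wagner condition for the holding cost `h` and the per-unit ordering cost `c`. -/
def VeinottWagner (c : ℝ) (h : ℝ → ℝ) : Prop :=
  ∃ z y : ℝ, z < y ∧ (h y - h z) / (y - z) < -c

/-- The kernel of `x + a - d` given `(x, a)`, where `d` has law `μ`. -/
def inventoryKernel (μ : Measure ℝ) : Kernel (ℝ × ℝ≥0) ℝ :=
  (Kernel.id ×ₖ Kernel.const (ℝ × ℝ≥0) μ).map (fun p => p.1.1 + (p.1.2 : ℝ) - p.2)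

instance (μ : Measure ℝ) [IsProbabilityMeasure μ] : IsMarkovKernel (inventoryKernel μ) :=
  Kernel.IsMarkovKernel.map _ (by fun_prop)

/-- The kernel of `x + w` given `x`, where `w` has law `ν`. -/
def noiseKernel (ν : Measure ℝ) : Kernel ℝ ℝ :=
  (Kernel.id ×ₖ Kernel.const ℝ ν).map (fun p => p.1 + p.2)

instance (ν : Measure ℝ) [IsProbabilityMeasure ν] : IsMarkovKernel (noiseKernel ν) :=
  Kernel.IsMarkovKernel.map _ (by fun_prop)

/-- The data of the Gaussian inventory problem with backorders and noisy observations. -/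
structure GaussianInventory where
  /-- fixed ordering cost -/
  K : ℝ≥0
  /-- per-unit ordering cost -/
  c : ℝ≥0
  /-- discount factor -/
  α : ℝ≥0
  /-- holding cost -/
  h : ℝ → ℝ
  /-- mean of the initial inventory level -/
  meanX : ℝ
  /-- variance of the initial inventory level -/
  varX : ℝ≥0
  /-- mean of the demand -/
  meanD : ℝ
  /-- variance of the demand -/
  varD : ℝ≥0
  /-- variance of the observation noise, whose mean is `0` -/
  varEta : ℝ≥0

namespace GaussianInventory

variable (M : GaussianInventory)

def demand : Measure ℝ := gaussianReal M.meanD M.varD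

instance : IsProbabilityMeasure M.demand := by unfold demand; infer_instance

def noise : Measure ℝ := gaussianReal 0 M.varEta

instance : IsProbabilityMeasure M.noise := by unfold noise; infer_instance

/-- The ordering cost `K · 1{a > 0} + c a`. -/
def orderCost (a : ℝ≥0) : ℝ≥0 := (if 0 < a then M.K else 0) + M.c * a

/-- The expected one-stage cost at the (hidden) inventory level `x`. -/
def cost (x : ℝ) (a : ℝ≥0) : ℝ≥0∞ :=
  M.orderCost a + ∫⁻ d, ENNReal.ofReal (M.h (x + a - d)) ∂M.demand

/-! ### The partially observable problem

A trajectory is a sequence of triples `((x_t, y_t), a_t)` of inventory level, observation, action. -/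

/-- The history `(y_0, a_0, …, y_{t-1}, a_{t-1}, y_t)` seen along a trajectory. -/
def hist (t : ℕ) (ω : ℕ → (ℝ × ℝ) × ℝ≥0) : Hist t :=
  (fun i => ((ω i).1.2, (ω i).2), (ω t).1.2)

/-- The history of period `n + 1`, from the trajectory up to period `n` and the next
(level, observation) pair. -/
def nextHist (n : ℕ) (p : (Finset.Iic n → (ℝ × ℝ) × ℝ≥0) × (ℝ × ℝ)) : Hist (n + 1) :=
  (fun i => ((p.1 ⟨i, Finset.mem_Iic.2 (Nat.le_of_lt_succ i.2)⟩).1.2,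
    (p.1 ⟨i, Finset.mem_Iic.2 (Nat.le_of_lt_succ i.2)⟩).2), p.2.2)

theorem measurable_nextHist (n : ℕ) : Measurable (nextHist n) := by
  unfold nextHist
  fun_prop

/-- The last (level, action) pair of the trajectory up to period `n`. -/
def lastLevel (n : ℕ) (p : Finset.Iic n → (ℝ × ℝ) × ℝ≥0) : ℝ × ℝ≥0 :=
  ((p ⟨n, Finset.mem_Iic.2 le_rfl⟩).1.1, (p ⟨n, Finset.mem_Iic.2 le_rfl⟩).2)

theorem measurable_lastLevel (n : ℕ) : Measurable (lastLevel n) := by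
  unfold lastLevel
  fun_prop

/-- The law of `((x_0, y_0), a_0)`. -/
def initLaw (π : Policy) : Measure ((ℝ × ℝ) × ℝ≥0) :=
  (gaussianReal M.meanX M.varX ⊗ₘ noiseKernel M.noise) ⊗ₘ
    (π.rule 0).comap (fun q : ℝ × ℝ => ((Fin.elim0, q.2) : Hist 0)) (by fun_prop)

instance (π : Policy) : IsProbabilityMeasure (M.initLaw π) := by unfold initLaw; infer_instance

/-- The conditional law of `((x_{n+1}, y_{n+1}), a_{n+1})` given the trajectory up to period `n`:
`x_{n+1} = x_n + a_n - D_n`, `y_{n+1} = x_{n+1} + η_{n+1}`, and `a_{n+1}` is drawn from the policy's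
decision rule at the observed history. -/
def stepKernel (π : Policy) (n : ℕ) :
    Kernel (Finset.Iic n → (ℝ × ℝ) × ℝ≥0) ((ℝ × ℝ) × ℝ≥0) :=
  ((inventoryKernel M.demand ⊗ₖ (noiseKernel M.noise).prodMkLeft (ℝ × ℝ≥0)).comap
      (lastLevel n) (measurable_lastLevel n)) ⊗ₖ
    (π.rule (n + 1)).comap (nextHist n) (measurable_nextHist n)

instance (π : Policy) (n : ℕ) : IsMarkovKernel (M.stepKernel π n) := by
  unfold stepKernel; infer_instance

/-- The law `P^π` of the trajectory under the policy `π`. -/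
def law (π : Policy) : Measure (ℕ → (ℝ × ℝ) × ℝ≥0) :=
  Kernel.trajMeasure (X := fun _ => (ℝ × ℝ) × ℝ≥0) (M.initLaw π) (M.stepKernel π)

instance (π : Policy) : IsProbabilityMeasure (M.law π) := by unfold law; infer_instance

/-- The expected total discounted cost of the policy `π` over the horizon `T`. -/
def totalCost (T : ℕ) (π : Policy) : ℝ≥0∞ :=
  ∫⁻ ω, ∑ t ∈ Finset.range T, (M.α : ℝ≥0∞) ^ t * M.cost (ω t).1.1 (ω t).2 ∂(M.law π)

/-- Optimality in the partially observable problem. -/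
def IsOptimal (T : ℕ) (φ : Policy) : Prop :=
  M.totalCost T φ = ⨅ π : Policy, M.totalCost T π

/-! ### Posterior means and variances

Quotients are in `ℝ≥0` or `ℝ`, where `0 / 0 = 0`.  Such a quotient occurs only if the inventory level
is already known exactly before the observation, and then the formulas below remain correct. -/

/-- The posterior variance `σ_t²` of the inventory level. -/
def postVar : ℕ → ℝ≥0
  | 0 => M.varX * M.varEta / (M.varX + M.varEta)
  | t + 1 => (postVar t + M.varD) * M.varEta / (postVar t + M.varD + M.varEta)

/-- The posterior mean of the inventory level `x_t` computed from the history. -/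
def postMean : ∀ t : ℕ, Hist t → ℝ
  | 0, p => M.meanX + (M.varX : ℝ) / (M.varX + M.varEta) * (p.2 - M.meanX)
  | t + 1, p =>
    let prior := postMean t (Fin.init p.1, (p.1 (Fin.last t)).1) + (p.1 (Fin.last t)).2 - M.meanD
    prior + ((M.postVar t : ℝ) + M.varD) / (M.postVar t + M.varD + M.varEta) * (p.2 - prior)

theorem measurable_postMean (t : ℕ) : Measurable (M.postMean t) := by
  induction t with
  | zero =>
    change Measurable fun p : Hist 0 =>
      M.meanX + (M.varX : ℝ) / (M.varX + M.varEta) * (p.2 - M.meanX)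
    fun_prop
  | succ t ih =>
    have h1 : Measurable fun p : Hist (t + 1) =>
        M.postMean t (Fin.init p.1, (p.1 (Fin.last t)).1) := by
      refine ih.comp ?_
      unfold Fin.init
      fun_prop
    have h2 : Measurable fun p : Hist (t + 1) =>
        M.postMean t (Fin.init p.1, (p.1 (Fin.last t)).1)
          + ((p.1 (Fin.last t)).2 : ℝ) - M.meanD := by
      fun_prop
    exact h2.add (measurable_const.mul (measurable_snd.sub h2))

/-! ### The time-dependent inventory problem for mean beliefs

It is completely observed; a trajectory is a sequence of pairs `(x̄_t, a_t)`. -/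

/-- The law of the demand `D*_t`. -/
def demandStar (t : ℕ) : Measure ℝ :=
  gaussianReal M.meanD ((M.postVar t + M.varD) ^ 2 / (M.postVar t + M.varD + M.varEta))

instance (t : ℕ) : IsProbabilityMeasure (M.demandStar t) := by unfold demandStar; infer_instance

/-- The transformed holding cost `h*_t(x) = E h(x + Z_t)`, where `Z_t ∼ N(0, σ_{t+1}²)`. -/
def hStar (t : ℕ) (x : ℝ) : ℝ≥0∞ :=
  ∫⁻ z, ENNReal.ofReal (M.h (x + z)) ∂(gaussianReal 0 (M.postVar (t + 1)))

/-- The one-stage cost of the inventory problem with holding costs `h*_t` and demands `D*_t`. -/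
def costStar (t : ℕ) (x : ℝ) (a : ℝ≥0) : ℝ≥0∞ :=
  M.orderCost a + ∫⁻ d, M.hStar t (x + a - d) ∂(M.demandStar t)

/-- The history of period `n + 1`, from the trajectory up to period `n` and the next state. -/
def nextHistStar (n : ℕ) (p : (Finset.Iic n → ℝ × ℝ≥0) × ℝ) : Hist (n + 1) :=
  (fun i => p.1 ⟨i, Finset.mem_Iic.2 (Nat.le_of_lt_succ i.2)⟩, p.2)

theorem measurable_nextHistStar (n : ℕ) : Measurable (nextHistStar n) := by
  unfold nextHistStar
  fun_prop

/-- The law of `(x̄_0, a_0)` for the initial state `x`. -/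
def initLawStar (π : Policy) (x : ℝ) : Measure (ℝ × ℝ≥0) :=
  Measure.dirac x ⊗ₘ
    (π.rule 0).comap (fun y : ℝ => ((Fin.elim0, y) : Hist 0)) (by fun_prop)

instance (π : Policy) (x : ℝ) : IsProbabilityMeasure (initLawStar π x) := by
  unfold initLawStar; infer_instance

/-- The conditional law of `(x̄_{n+1}, a_{n+1})` given the trajectory up to period `n`, where
`x̄_{n+1} = x̄_n + a_n - D*_n`. -/
def stepKernelStar (π : Policy) (n : ℕ) : Kernel (Finset.Iic n → ℝ × ℝ≥0) (ℝ × ℝ≥0) :=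
  ((inventoryKernel (M.demandStar n)).comap
      (fun p : Finset.Iic n → ℝ × ℝ≥0 => p ⟨n, Finset.mem_Iic.2 le_rfl⟩) (by fun_prop)) ⊗ₖ
    (π.rule (n + 1)).comap (nextHistStar n) (measurable_nextHistStar n)

instance (π : Policy) (n : ℕ) : IsMarkovKernel (M.stepKernelStar π n) := by
  unfold stepKernelStar; infer_instance

/-- The law of the trajectory under the policy `π` from the initial state `x`. -/
def lawStar (π : Policy) (x : ℝ) : Measure (ℕ → ℝ × ℝ≥0) :=
  Kernel.trajMeasure (X := fun _ => ℝ × ℝ≥0) (initLawStar π x) (M.stepKernelStar π)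

/-- The expected total discounted cost over the horizon `T` from the initial state `x`. -/
def totalCostStar (T : ℕ) (π : Policy) (x : ℝ) : ℝ≥0∞ :=
  ∫⁻ ω, ∑ t ∈ Finset.range T, (M.α : ℝ≥0∞) ^ t * M.costStar t (ω t).1 (ω t).2 ∂(M.lawStar π x)

/-- Optimality, simultaneously for all initial states, in the problem for mean beliefs. -/
def IsOptimalStar (T : ℕ) (φ : Policy) : Prop :=
  ∀ x : ℝ, M.totalCostStar T φ x = ⨅ π : Policy, M.totalCostStar T π x

/-- The Markov `(s_t, S_t)`-policy of a completely observed problem. -/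
def ssPolicy (s S : ℕ → ℝ) : Policy :=
  Policy.ofFun (fun t p => ssOrder (s t) (S t) p.2)
    (fun t => (measurable_ssOrder (s t) (S t)).comp measurable_snd)

/-- The policy of the partially observable problem that applies the `(s_t, S_t)` rule to the
posterior mean computed from the history. -/
def ssBeliefPolicy (s S : ℕ → ℝ) : Policy :=
  Policy.ofFun (fun t p => ssOrder (s t) (S t) (M.postMean t p))
    (fun t => (measurable_ssOrder (s t) (S t)).comp (M.measurable_postMean t))

end GaussianInventory

end

/-! Normal beliefs stay normal under orders, demands and observations, and their variances do not
depend on the data, so the posterior mean is a sufficient statistic. Put `V = σ_t² + σ_D²` and `r =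
σ_η²`. The prior variance `V` splits into the variance `V² / (V + r)` of the next posterior mean and
the variance `V r / (V + r)` that remains after the observation. The first is the variance of
`D*_t`, so posterior means move like levels of the mean-belief problem. The second is the variance
of `Z_t`, so averaging the hidden cost over the belief gives `c*_t`.

Both problems are then settled by one verification argument on an abstract measure space. If levels
move in law by the demands `D*_t` (`IsControlled`), the recursion `valueStar` bounds the cost from
below, with equality if the orders attain its minima (`FollowsRule`).

That `(s, S)` rules attain these minima is Scarf's argument. If the expected cost `L` after ordering
is `K`-convex and lower semicontinuous, and `c y + L y` is coercive, then some `(s, S)` rule is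
optimal (`exists_isOrderPair`, `orderValue_eq`), and the resulting value is again `K`-convex and
lower semicontinuous. Coercivity holds because `L y ≥ h (y - D̄)` by Jensen, and on the far left `h`
falls at a rate above `c` by Veinott–Wagner. Only one-step expectations of `h*_t` are assumed
finite, so values are allowed to be infinite, and lower semicontinuity, preserved by Fatou's lemma,
replaces continuity. Strictness `s < S` comes from discounting: starting the next period slightly
lower costs little more than `α K`, which is less than `K`. -/

noncomputable section

/-! ### Gaussian measures -/

/-- An affine combination of two independent normal variables is normal. -/
theorem gaussianReal_prod_map_affine (m₁ m₂ : ℝ) (v₁ v₂ : ℝ≥0) (a b e : ℝ) (u : ℝ≥0)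
    (hu : (u : ℝ) = a ^ 2 * v₁ + b ^ 2 * v₂) :
    ((gaussianReal m₁ v₁).prod (gaussianReal m₂ v₂)).map (fun p => a * p.1 + b * p.2 + e)
      = gaussianReal (a * m₁ + b * m₂ + e) u := by
  have h1 : (fun p : ℝ × ℝ => a * p.1 + b * p.2 + e)
      = (fun x => x + e) ∘ (fun p : ℝ × ℝ => p.1 + p.2) ∘ Prod.map (a * ·) (b * ·) := by
    ext p; simp
  have h2 : u = .mk (a ^ 2) (sq_nonneg _) * v₁ + .mk (b ^ 2) (sq_nonneg _) * v₂ := by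
    ext; simpa using hu
  rw [h1, ← Measure.map_map (by fun_prop) (by fun_prop),
    ← Measure.map_map (by fun_prop) (by fun_prop),
    ← Measure.map_prod_map _ _ (by fun_prop) (by fun_prop), gaussianReal_map_const_mul,
    gaussianReal_map_const_mul]
  change ((gaussianReal _ _) ∗ (gaussianReal _ _)).map _ = _
  rw [gaussianReal_conv_gaussianReal, gaussianReal_map_add_const, h2]

theorem lintegral_gaussianReal_affine (m₁ m₂ : ℝ) (v₁ v₂ : ℝ≥0) (a b e m : ℝ) (u : ℝ≥0)
    (hm : m = a * m₁ + b * m₂ + e) (hu : (u : ℝ) = a ^ 2 * v₁ + b ^ 2 * v₂)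
    {f : ℝ → ℝ≥0∞} (hf : Measurable f) :
    ∫⁻ x, ∫⁻ y, f (a * x + b * y + e) ∂(gaussianReal m₂ v₂) ∂(gaussianReal m₁ v₁)
      = ∫⁻ z, f z ∂(gaussianReal m u) := by
  rw [hm, ← gaussianReal_prod_map_affine m₁ m₂ v₁ v₂ a b e u hu,
    lintegral_map hf (by fun_prop), lintegral_prod _ (by fun_prop)]

/-- Conditioning in a bivariate normal distribution: if `w ∼ N(m, v)` is observed as `y = w + e` with
independent noise `e ∼ N(0, r)`, then `y ∼ N(m, v + r)`, and `w` given `y` is normal. -/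
theorem gaussianReal_prod_map_eq_posterior (m : ℝ) (v r : ℝ≥0) :
    ((gaussianReal m v).prod (gaussianReal 0 r)).map (fun p => (p.1 + p.2, p.1))
      = ((gaussianReal m (v + r)).prod (gaussianReal 0 (v * r / (v + r)))).map
        (fun p => (p.1, m + (v : ℝ) / (v + r) * (p.1 - m) + p.2)) := by
  have hm1 : Measurable (fun p : ℝ × ℝ => (p.1 + p.2, p.1)) := by fun_prop
  have hm2 : Measurable (fun p : ℝ × ℝ => (p.1, m + (v : ℝ) / (v + r) * (p.1 - m) + p.2)) := by
    fun_prop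
  have := Measure.isProbabilityMeasure_map (μ := (gaussianReal m v).prod (gaussianReal 0 r))
    hm1.aemeasurable
  have := Measure.isProbabilityMeasure_map
    (μ := (gaussianReal m (v + r)).prod (gaussianReal 0 (v * r / (v + r)))) hm2.aemeasurable
  -- Cramér–Wold: under every linear functional both sides become normal on the line, so it suffices
  -- to match means and variances.
  refine Measure.ext_of_charFunDual ?_
  ext L
  rw [charFunDual_eq_charFun_map_one, charFunDual_eq_charFun_map_one,
    Measure.map_map (by fun_prop) hm1, Measure.map_map (by fun_prop) hm2]
  have hL : ∀ p : ℝ × ℝ, L p = L (1, 0) * p.1 + L (0, 1) * p.2 := by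
    intro p
    have : p = p.1 • ((1, 0) : ℝ × ℝ) + p.2 • ((0, 1) : ℝ × ℝ) := by ext <;> simp
    conv_lhs => rw [this, map_add, map_smul, map_smul]
    simp [mul_comm]
  set s := L (1, 0)
  set t := L (0, 1)
  set g : ℝ := (v : ℝ) / (v + r) with hg
  have e1 : L ∘ (fun p : ℝ × ℝ => (p.1 + p.2, p.1))
      = fun p => (s + t) * p.1 + s * p.2 + 0 := by
    ext p; simp only [Function.comp, hL]; ring
  have e2 : L ∘ (fun p : ℝ × ℝ => (p.1, m + g * (p.1 - m) + p.2))
      = fun p => (s + t * g) * p.1 + t * p.2 + t * (m - g * m) := by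
    ext p; simp only [Function.comp, hL]; ring
  have hu : 0 ≤ (s + t) ^ 2 * (v : ℝ) + s ^ 2 * r := by positivity
  rw [e1, e2, gaussianReal_prod_map_affine _ _ _ _ _ _ _ ⟨_, hu⟩ rfl,
    gaussianReal_prod_map_affine _ _ _ _ _ _ _ ⟨_, hu⟩]
  · congr 2; ring
  · change (s + t) ^ 2 * (v : ℝ) + s ^ 2 * r = _
    simp only [NNReal.coe_add, NNReal.coe_div, NNReal.coe_mul, hg]
    -- If `v + r = 0`, both variances vanish and the gain `0 / 0 = 0` is harmless.
    rcases eq_or_ne ((v : ℝ) + r) 0 with h0 | h0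
    · have hv : (v : ℝ) = 0 := by linarith [v.coe_nonneg, r.coe_nonneg]
      have hr : (r : ℝ) = 0 := by linarith [v.coe_nonneg, r.coe_nonneg]
      simp [hv, hr]
    · field_simp; ring

theorem lintegral_gaussianReal_posterior (m : ℝ) (v r : ℝ≥0) {f : ℝ → ℝ → ℝ≥0∞}
    (hf : Measurable (Function.uncurry f)) :
    ∫⁻ w, ∫⁻ e, f (w + e) w ∂(gaussianReal 0 r) ∂(gaussianReal m v)
      = ∫⁻ y, ∫⁻ w, f y w ∂(gaussianReal (m + (v : ℝ) / (v + r) * (y - m)) (v * r / (v + r)))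
          ∂(gaussianReal m (v + r)) := by
  have h := congrArg (fun μ => ∫⁻ p, Function.uncurry f p ∂μ)
    (gaussianReal_prod_map_eq_posterior m v r)
  rw [lintegral_map hf (by fun_prop), lintegral_map hf (by fun_prop),
    lintegral_prod _ (by fun_prop), lintegral_prod _ (by fun_prop)] at h
  simp only [Function.uncurry_apply_pair] at h
  rw [h]
  refine lintegral_congr fun y => ?_
  have := gaussianReal_map_const_add (μ := 0) (v := v * r / (v + r))
    (m + (v : ℝ) / (v + r) * (y - m))
  rw [zero_add] at this
  rw [← this, lintegral_map (by fun_prop) (by fun_prop)]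

/-- Jensen's inequality for the normal distribution and a nonnegative midpoint-convex function. -/
theorem le_lintegral_gaussianReal_of_midpoint {f : ℝ → ℝ≥0∞} (hf : Measurable f)
    (hmid : ∀ x u, 2 * f x ≤ f (x + u) + f (x - u)) (x m : ℝ) (v : ℝ≥0) :
    f (x - m) ≤ ∫⁻ d, f (x - d) ∂(gaussianReal m v) := by
  have h1 : ∫⁻ d, f (x - d) ∂(gaussianReal m v) = ∫⁻ u, f (x - m + u) ∂(gaussianReal 0 v) := by
    have := gaussianReal_map_const_sub (μ := 0) (v := v) m
    rw [sub_zero] at this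
    rw [← this, lintegral_map (by fun_prop) (by fun_prop)]
    refine lintegral_congr fun u => ?_
    congr 1; ring
  -- The centred law is symmetric, so the midpoint inequality can be averaged over pairs `±u`. No
  -- integrability of `f` is needed.
  have h2 : ∫⁻ u, f (x - m + u) ∂(gaussianReal 0 v) = ∫⁻ u, f (x - m - u) ∂(gaussianReal 0 v) := by
    have := gaussianReal_map_neg (μ := 0) (v := v)
    rw [neg_zero] at this
    conv_lhs => rw [← this, lintegral_map (by fun_prop) (by fun_prop)]
    rfl
  have h3 : 2 * f (x - m) ≤ 2 * ∫⁻ d, f (x - d) ∂(gaussianReal m v) := by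
    calc 2 * f (x - m) = ∫⁻ _u, 2 * f (x - m) ∂(gaussianReal 0 v) := by simp
      _ ≤ ∫⁻ u, (f (x - m + u) + f (x - m - u)) ∂(gaussianReal 0 v) :=
        lintegral_mono fun u => hmid _ u
      _ = 2 * ∫⁻ d, f (x - d) ∂(gaussianReal m v) := by
        rw [lintegral_add_left (by fun_prop), ← h2, h1, two_mul]
  exact (ENNReal.mul_le_mul_iff_right (by norm_num) (by norm_num)).1 h3

/-! ### Scarf's `K`-convexity for functions with values in `[0, ∞]` -/

/-- `K`-convexity of a function with values in `[0, ∞]`. -/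
def KConvex (K : ℝ≥0) (f : ℝ → ℝ≥0∞) : Prop :=
  ∀ ⦃x y : ℝ⦄, x ≤ y → ∀ p q : ℝ≥0, p + q = 1 → f (p * x + q * y) ≤ p * f x + q * (f y + K)

namespace KConvex

variable {K : ℝ≥0} {f g : ℝ → ℝ≥0∞}

/-- The real form, cleared of denominators, makes later case distinctions linear arithmetic;
finiteness at the ends passes to the points between. -/
theorem chord (hf : KConvex K f) {x z y : ℝ} (hxz : x ≤ z) (hzy : z ≤ y) (hxy : x < y)
    (hx : f x ≠ ∞) (hy : f y ≠ ∞) :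
    f z ≠ ∞ ∧
      (y - x) * (f z).toReal ≤ (y - z) * (f x).toReal + (z - x) * ((f y).toReal + K) := by
  have hd : 0 < y - x := by linarith
  have hp : 0 ≤ (y - z) / (y - x) := div_nonneg (by linarith) hd.le
  have hq : 0 ≤ (z - x) / (y - x) := div_nonneg (by linarith) hd.le
  have hz : (y - z) / (y - x) * x + (z - x) / (y - x) * y = z := by field_simp; ring
  have h := hf hxy.le ((y - z) / (y - x)).toNNReal ((z - x) / (y - x)).toNNReal (by
    rw [← Real.toNNReal_add hp hq, ← add_div]
    convert Real.toNNReal_one using 2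
    field_simp; ring)
  rw [Real.coe_toNNReal _ hp, Real.coe_toNNReal _ hq, hz] at h
  have hr : (((y - z) / (y - x)).toNNReal : ℝ≥0∞) * f x
      + ((z - x) / (y - x)).toNNReal * (f y + K) ≠ ∞ := by finiteness
  refine ⟨ne_top_of_le_ne_top hr h, ?_⟩
  have h' := ENNReal.toReal_mono hr h
  rw [ENNReal.toReal_add (by finiteness) (by finiteness), ENNReal.toReal_mul, ENNReal.toReal_mul,
    ENNReal.toReal_add hy (by finiteness), ENNReal.coe_toReal, ENNReal.coe_toReal,
    ENNReal.coe_toReal, Real.coe_toNNReal _ hp, Real.coe_toNNReal _ hq] at h'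
  calc (y - x) * (f z).toReal
      ≤ (y - x) * ((y - z) / (y - x) * (f x).toReal
        + (z - x) / (y - x) * ((f y).toReal + K)) := by gcongr
    _ = _ := by field_simp

/-- Only finite ends and interior points matter: an infinite end with positive weight makes the
bound trivial, and a zero weight removes its end because `0 * ∞ = 0`. -/
theorem of_chord (h : ∀ x z y : ℝ, x < z → z < y → f x ≠ ∞ → f y ≠ ∞ → f z ≠ ∞ ∧
      (y - x) * (f z).toReal ≤ (y - z) * (f x).toReal + (z - x) * ((f y).toReal + K)) :
    KConvex K f := by
  intro x y hxy p q hpq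
  have hpq' : (p : ℝ) + q = 1 := by exact_mod_cast hpq
  rcases eq_or_ne p 0 with rfl | hp
  · have hq : q = 1 := by simpa using hpq
    simp [hq]
  rcases eq_or_ne q 0 with rfl | hq
  · have hp : p = 1 := by simpa using hpq
    simp [hp]
  rcases eq_or_ne (f x) ∞ with hx | hx
  · simp [hx, hp]
  rcases eq_or_ne (f y) ∞ with hy | hy
  · simp [hy, hq]
  rcases hxy.eq_or_lt with rfl | hxy
  · have : (p : ℝ) * x + q * x = x := by rw [← add_mul, hpq', one_mul]
    rw [this, mul_add, ← add_assoc, ← add_mul, ← ENNReal.coe_add, hpq, ENNReal.coe_one, one_mul]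
    exact le_self_add
  have hp0 : (0 : ℝ) < p := by positivity
  have hq0 : (0 : ℝ) < q := by positivity
  have e1 : y - (p * x + q * y) = p * (y - x) := by linear_combination (-y) * hpq'
  have e2 : (p * x + q * y) - x = q * (y - x) := by linear_combination x * hpq'
  have hd : 0 < y - x := by linarith
  obtain ⟨hz, hle⟩ := h x (p * x + q * y) y
    (by nlinarith [mul_pos hq0 hd]) (by nlinarith [mul_pos hp0 hd]) hx hy
  rw [e1, e2] at hle
  have hle' : (f (p * x + q * y)).toReal ≤ p * (f x).toReal + q * ((f y).toReal + K) := by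
    refine le_of_mul_le_mul_left ?_ hd
    linarith
  rw [← ENNReal.toReal_le_toReal hz (by finiteness),
    ENNReal.toReal_add (by finiteness) (by finiteness), ENNReal.toReal_mul, ENNReal.toReal_mul,
    ENNReal.toReal_add hy (by finiteness)]
  simpa using hle'

theorem mono {K' : ℝ≥0} (hf : KConvex K f) (h : K ≤ K') : KConvex K' f := by
  intro x y hxy p q hpq
  refine (hf hxy p q hpq).trans ?_
  gcongr

theorem add {K' : ℝ≥0} (hf : KConvex K f) (hg : KConvex K' g) :
    KConvex (K + K') (fun x => f x + g x) := by
  intro x y hxy p q hpq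
  refine (add_le_add (hf hxy p q hpq) (hg hxy p q hpq)).trans (le_of_eq ?_)
  push_cast
  ring

theorem const_mul (hf : KConvex K f) (a : ℝ≥0) : KConvex (a * K) (fun x => a * f x) := by
  intro x y hxy p q hpq
  refine (mul_le_mul_right (hf hxy p q hpq) (a : ℝ≥0∞)).trans (le_of_eq ?_)
  push_cast
  ring

theorem lintegral_sub (hf : KConvex K f) (hm : Measurable f) (μ : Measure ℝ)
    [IsProbabilityMeasure μ] : KConvex K (fun y => ∫⁻ d, f (y - d) ∂μ) := by
  intro x y hxy p q hpq
  have hpq' : (p : ℝ) + q = 1 := by exact_mod_cast hpq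
  calc ∫⁻ d, f (p * x + q * y - d) ∂μ
      ≤ ∫⁻ d, (p * f (x - d) + q * (f (y - d) + K)) ∂μ := by
        refine lintegral_mono fun d => ?_
        have h := hf (sub_le_sub_right hxy d) p q hpq
        have e : (p : ℝ) * (x - d) + q * (y - d) = p * x + q * y - d := by
          linear_combination (-d) * hpq'
        rwa [e] at h
    _ = _ := by
        rw [lintegral_add_left (by fun_prop), lintegral_const_mul _ (by fun_prop),
          lintegral_const_mul _ (by fun_prop), lintegral_add_left (by fun_prop)]
        simp

theorem zero : KConvex K (fun _ => 0) := by
  intro x y _ p q _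
  simp

/-- A convex nonnegative real function is `0`-convex. -/
theorem ofReal_of_convexOn {h : ℝ → ℝ} (hc : ConvexOn ℝ Set.univ h) (h0 : ∀ x, 0 ≤ h x) :
    KConvex 0 (fun x => ENNReal.ofReal (h x)) := by
  intro x y _ p q hpq
  have hpq' : (p : ℝ) + q = 1 := by exact_mod_cast hpq
  have := hc.2 (Set.mem_univ x) (Set.mem_univ y) p.coe_nonneg q.coe_nonneg hpq'
  simp only [smul_eq_mul] at this
  refine (ENNReal.ofReal_le_ofReal this).trans ?_
  rw [ENNReal.ofReal_add (mul_nonneg p.coe_nonneg (h0 x)) (mul_nonneg q.coe_nonneg (h0 y)),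
    ENNReal.ofReal_mul p.coe_nonneg, ENNReal.ofReal_mul q.coe_nonneg]
  simp

theorem convexOn_toReal (hf : KConvex 0 f) (hfin : ∀ x, f x ≠ ∞) :
    ConvexOn ℝ Set.univ (fun x => (f x).toReal) := by
  refine LinearOrder.convexOn_of_lt convex_univ ?_
  intro x _ y _ hxy a b ha hb hab
  have h := hf hxy.le a.toNNReal b.toNNReal (by
    rw [← Real.toNNReal_add ha.le hb.le, hab, Real.toNNReal_one])
  rw [Real.coe_toNNReal _ ha.le, Real.coe_toNNReal _ hb.le] at h
  have hx := hfin x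
  have hy := hfin y
  have h' := ENNReal.toReal_mono (by finiteness) h
  rw [ENNReal.toReal_add (by finiteness) (by finiteness), ENNReal.toReal_mul,
    ENNReal.toReal_mul] at h'
  simpa [ha.le, hb.le] using h'

end KConvex

/-- Averaging preserves lower semicontinuity, by Fatou's lemma. -/
theorem LowerSemicontinuous.lintegral_sub {f : ℝ → ℝ≥0∞} (hf : LowerSemicontinuous f)
    (μ : Measure ℝ) : LowerSemicontinuous (fun y => ∫⁻ d, f (y - d) ∂μ) := by
  have hm := hf.measurable
  rw [lowerSemicontinuous_iff_le_liminf]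
  intro y
  calc ∫⁻ d, f (y - d) ∂μ ≤ ∫⁻ d, liminf (fun x => f (x - d)) (𝓝 y) ∂μ := by
        refine lintegral_mono fun d => ?_
        exact lowerSemicontinuous_iff_le_liminf.1
          (LowerSemicontinuous.comp hf (g := fun x => x - d) (by fun_prop)) y
    _ ≤ _ := lintegral_liminf_le fun x => by fun_prop

/-! ### Optimal `(s, S)` rules for one period -/

/-- The levels `s ≤ S` determine an optimal ordering rule for the expected cost `L` after ordering:
`S` minimizes `c y + L y`, and `s` is the lowest level at which this function is at most `K` above
its minimum. -/
structure IsOrderPair (K c : ℝ≥0) (L : ℝ → ℝ≥0∞) (s S : ℝ) : Prop where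
  le : s ≤ S
  finite_right : L S ≠ ∞
  finite_left : L s ≠ ∞
  min : ∀ y, L y ≠ ∞ → c * S + (L S).toReal ≤ c * y + (L y).toReal
  left_le : c * s + (L s).toReal ≤ c * S + (L S).toReal + K
  lt_of_lt : ∀ x < s, L x ≠ ∞ → c * S + (L S).toReal + K < c * x + (L x).toReal

/-- Coercivity makes `c y + L y` exceed its value at `y₀` by more than `K` off a compact interval.
So `S` is a minimizer of a lower semicontinuous function on a compact set, and `s` the least point
of a compact sublevel set. -/
theorem exists_isOrderPair {K c : ℝ≥0} {L : ℝ → ℝ≥0∞} {g : ℝ → ℝ}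
    (hlsc : LowerSemicontinuous L) (hg : Tendsto g (cocompact ℝ) atTop)
    (hgL : ∀ y, L y ≠ ∞ → g y ≤ c * y + (L y).toReal) {y₀ : ℝ} (hy₀ : L y₀ ≠ ∞) :
    ∃ s S, IsOrderPair K c L s S := by
  have hev := hg.eventually_gt_atTop (c * y₀ + (L y₀).toReal + K)
  rw [cocompact_eq_atBot_atTop, eventually_sup, eventually_atBot, eventually_atTop] at hev
  obtain ⟨⟨A', hA'⟩, B', hB'⟩ := hev
  set A := Min.min A' y₀
  set B := max B' y₀
  have hA : ∀ x < A, L x ≠ ∞ → c * y₀ + (L y₀).toReal + K < c * x + (L x).toReal :=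
    fun x hx hL => (hA' x (hx.le.trans (min_le_left _ _))).trans_le (hgL x hL)
  have hB : ∀ x, B < x → L x ≠ ∞ → c * y₀ + (L y₀).toReal + K < c * x + (L x).toReal :=
    fun x hx hL => (hB' x ((le_max_left _ _).trans hx.le)).trans_le (hgL x hL)
  -- Shifting by the constant `c A` keeps the linear part nonnegative on `[A, ∞)`, where
  -- `ENNReal.ofReal` then truncates nothing.
  set F : ℝ → ℝ≥0∞ := fun y => ENNReal.ofReal (c * (y - A)) + L y with hF
  have hFlsc : LowerSemicontinuous F :=
    LowerSemicontinuous.add (ENNReal.continuous_ofReal.comp (by fun_prop)).lowerSemicontinuous hlsc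
  have hFle : ∀ x y k, A ≤ x → A ≤ y → L x ≠ ∞ → F y ≤ F x + (k : ℝ≥0) →
      L y ≠ ∞ ∧ c * y + (L y).toReal ≤ c * x + (L x).toReal + k := by
    intro x y k hx hy hLx h
    have hfin : F x + (k : ℝ≥0) ≠ ∞ := by simp only [hF]; finiteness
    have hLy : L y ≠ ∞ := ne_top_of_le_ne_top hfin (le_add_self.trans h)
    refine ⟨hLy, ?_⟩
    have h' := ENNReal.toReal_mono hfin h
    simp only [hF] at h'
    rw [ENNReal.toReal_add (by finiteness) (by finiteness),
      ENNReal.toReal_add (by finiteness) (by finiteness),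
      ENNReal.toReal_add (by finiteness) (by finiteness),
      ENNReal.toReal_ofReal (mul_nonneg c.coe_nonneg (by linarith)),
      ENNReal.toReal_ofReal (mul_nonneg c.coe_nonneg (by linarith)), ENNReal.coe_toReal] at h'
    linarith
  have hy₀A : A ≤ y₀ := min_le_right _ _
  have hy₀B : y₀ ≤ B := le_max_right _ _
  obtain ⟨S, hS, hSmin⟩ := LowerSemicontinuousOn.exists_isMinOn (Set.nonempty_Icc.2 (hy₀A.trans hy₀B))
    isCompact_Icc (hFlsc.lowerSemicontinuousOn (Set.Icc A B))
  have hSy₀ := hFle y₀ S 0 hy₀A hS.1 hy₀ (by simpa using hSmin ⟨hy₀A, hy₀B⟩)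
  have hS0 : c * S + (L S).toReal ≤ c * y₀ + (L y₀).toReal := by simpa using hSy₀.2
  have hmin : ∀ y, L y ≠ ∞ → c * S + (L S).toReal ≤ c * y + (L y).toReal := by
    intro y hy
    by_cases h1 : y < A
    · linarith [hA y h1 hy, K.coe_nonneg]
    by_cases h2 : B < y
    · linarith [hB y h2 hy, K.coe_nonneg]
    push Not at h1 h2
    simpa using (hFle y S 0 h1 hS.1 hy (by simpa using hSmin ⟨h1, h2⟩)).2
  have hcl : IsClosed (F ⁻¹' Set.Iic (F S + K)) := hFlsc.isClosed_preimage _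
  have hcpt : IsCompact (Set.Icc A S ∩ F ⁻¹' Set.Iic (F S + K)) := isCompact_Icc.inter_right hcl
  obtain ⟨s, ⟨hs1, hs2⟩, hsleast⟩ := hcpt.exists_isLeast ⟨S, ⟨hS.1, le_rfl⟩, by simp⟩
  have hs := hFle S s K hS.1 hs1.1 hSy₀.1 hs2
  refine ⟨s, S, hs1.2, hSy₀.1, hs.1, hmin, hs.2, ?_⟩
  intro x hx hLx
  by_contra! hcon
  by_cases h1 : x < A
  · linarith [hA x h1 hLx]
  push Not at h1
  refine absurd (hsleast ⟨⟨h1, hx.le.trans hs1.2⟩, ?_⟩) (not_le.2 hx)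
  have hLS := hSy₀.1
  change F x ≤ F S + K
  simp only [hF]
  rw [← ENNReal.toReal_le_toReal (by finiteness) (by finiteness),
    ENNReal.toReal_add (by finiteness) (by finiteness),
    ENNReal.toReal_add (by finiteness) (by finiteness),
    ENNReal.toReal_add (by finiteness) (by finiteness),
    ENNReal.toReal_ofReal (mul_nonneg c.coe_nonneg (by linarith)),
    ENNReal.toReal_ofReal (mul_nonneg c.coe_nonneg (by linarith [hS.1])), ENNReal.coe_toReal]
  linarith

namespace IsOrderPair

variable {K c : ℝ≥0} {L : ℝ → ℝ≥0∞} {s S : ℝ}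

theorem lt (h : IsOrderPair K c L s S)
    (hK : ∃ x < S, L x ≠ ∞ ∧ c * x + (L x).toReal ≤ c * S + (L S).toReal + K) : s < S := by
  obtain ⟨x, hxS, hLx, hx⟩ := hK
  by_contra! hcon
  exact absurd (h.lt_of_lt x (hxS.trans_le hcon) hLx) (not_lt.2 hx)

/-- At or above `s` it does not pay to order. -/
theorem le_of_le (h : IsOrderPair K c L s S) (hL : KConvex K L) {x y : ℝ} (hsx : s ≤ x)
    (hxy : x ≤ y) (hLy : L y ≠ ∞) :
    L x ≠ ∞ ∧ c * x + (L x).toReal ≤ c * y + (L y).toReal + K := by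
  have hmin := h.min y hLy
  -- Up to `S`, the chord over `[s, S]` keeps `c x + L x` within `K` of the minimum. Beyond `S`, the
  -- chord over `[S, y]` is used, with the minimum at its left end.
  rcases le_or_gt x S with hxS | hSx
  · rcases h.le.eq_or_lt with hsS | hsS
    · obtain rfl : x = S := le_antisymm hxS (hsS ▸ hsx)
      exact ⟨h.finite_right, by linarith [K.coe_nonneg]⟩
    obtain ⟨hfin, hle⟩ := hL.chord hsx hxS hsS h.finite_left h.finite_right
    refine ⟨hfin, ?_⟩
    have hd : 0 < S - s := by linarith
    have : (S - s) * (c * x + (L x).toReal) ≤ (S - s) * (c * S + (L S).toReal + K) := by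
      nlinarith [mul_le_mul_of_nonneg_left h.left_le (sub_nonneg.2 hxS)]
    linarith [le_of_mul_le_mul_left this hd]
  · obtain ⟨hfin, hle⟩ := hL.chord hSx.le hxy (hSx.trans_le hxy) h.finite_right hLy
    refine ⟨hfin, ?_⟩
    have hd : 0 < y - S := by linarith
    have : (y - S) * (c * x + (L x).toReal) ≤ (y - S) * (c * y + (L y).toReal + K) := by
      nlinarith [mul_le_mul_of_nonneg_left hmin (sub_nonneg.2 hxy),
        mul_nonneg K.coe_nonneg (sub_nonneg.2 hxy)]
    exact le_of_mul_le_mul_left this hd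

end IsOrderPair

/-- The expected cost under the `(s, S)` rule. -/
def orderPairValue (K c : ℝ≥0) (L : ℝ → ℝ≥0∞) (s S x : ℝ) : ℝ≥0∞ :=
  if x < s then ENNReal.ofReal (K + c * (S - x)) + L S else L x

namespace IsOrderPair

variable {K c : ℝ≥0} {L : ℝ → ℝ≥0∞} {s S : ℝ}

theorem lowerSemicontinuous_value (h : IsOrderPair K c L s S) (hL : LowerSemicontinuous L) :
    LowerSemicontinuous (orderPairValue K c L s S) := by
  have hk : LowerSemicontinuous fun x : ℝ => ENNReal.ofReal (K + c * (S - x)) + L S :=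
    LowerSemicontinuous.add (ENNReal.continuous_ofReal.comp (by fun_prop)).lowerSemicontinuous
      lowerSemicontinuous_const
  intro x r hr
  change ∀ᶠ x' in 𝓝 x, r < orderPairValue K c L s S x'
  change r < orderPairValue K c L s S x at hr
  rcases lt_trichotomy x s with hx | rfl | hx
  · rw [orderPairValue, if_pos hx] at hr
    filter_upwards [hk x r hr, Iio_mem_nhds hx] with x' h1 h2
    rwa [orderPairValue, if_pos (Set.mem_Iio.1 h2)]
  · rw [orderPairValue, if_neg (lt_irrefl _)] at hr
    -- At `s` the ordering branch lies at or above `L s`, so the value cannot jump down on the left.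
    have hr' : r < ENNReal.ofReal (K + c * (S - x)) + L S := by
      refine hr.trans_le ?_
      have h1 := h.finite_left
      have h2 := h.finite_right
      have h3 : 0 ≤ K + c * (S - x) :=
        add_nonneg K.coe_nonneg (mul_nonneg c.coe_nonneg (sub_nonneg.2 h.le))
      rw [← ENNReal.toReal_le_toReal h1 (by finiteness),
        ENNReal.toReal_add (by finiteness) h2, ENNReal.toReal_ofReal h3]
      linarith [h.left_le]
    filter_upwards [hk x r hr', hL x r hr] with x' h1 h2
    unfold orderPairValue
    split_ifs
    exacts [h1, h2]
  · rw [orderPairValue, if_neg hx.le.not_gt] at hr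
    filter_upwards [hL x r hr, Ioi_mem_nhds hx] with x' h1 h2
    rwa [orderPairValue, if_neg (Set.mem_Ioi.1 h2).le.not_gt]

/-- After adding `c x`, the value is the constant `min + K` below `s` and `c x + L x` from `s` on.
The cases follow the positions of `x`, `z`, `y` relative to `s` and `S`. -/
theorem kConvex_value (h : IsOrderPair K c L s S) (hL : KConvex K L) :
    KConvex K (orderPairValue K c L s S) := by
  have hlow : ∀ x < s, (orderPairValue K c L s S x).toReal = K + c * (S - x) + (L S).toReal := by
    intro x hx
    have h3 : 0 ≤ K + c * (S - x) :=
      add_nonneg K.coe_nonneg (mul_nonneg c.coe_nonneg (by linarith [h.le]))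
    rw [orderPairValue, if_pos hx, ENNReal.toReal_add (by finiteness) h.finite_right,
      ENNReal.toReal_ofReal h3]
  have hlow' : ∀ x < s, orderPairValue K c L s S x ≠ ∞ := by
    intro x hx
    have := h.finite_right
    rw [orderPairValue, if_pos hx]
    finiteness
  have hhigh : ∀ x, s ≤ x → orderPairValue K c L s S x = L x := by
    intro x hx
    rw [orderPairValue, if_neg hx.not_gt]
  refine KConvex.of_chord fun x z y hxz hzy hx hy => ?_
  have h1 : 0 < y - z := by linarith
  have h2 : 0 < z - x := by linarith
  rcases le_or_gt s x with hsx | hxs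
  · rw [hhigh x hsx] at hx ⊢
    rw [hhigh y (by linarith)] at hy ⊢
    rw [hhigh z (by linarith)]
    exact hL.chord hxz.le hzy.le (by linarith) hx hy
  rcases lt_or_ge y s with hys | hsy
  · refine ⟨hlow' z (by linarith), ?_⟩
    rw [hlow x hxs, hlow y hys, hlow z (by linarith)]
    nlinarith [mul_nonneg K.coe_nonneg h2.le]
  rw [hhigh y hsy] at hy ⊢
  have hmin := h.min y hy
  rw [hlow x hxs]
  rcases lt_or_ge z s with hzs | hsz
  · refine ⟨hlow' z hzs, ?_⟩
    rw [hlow z hzs]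
    nlinarith [mul_le_mul_of_nonneg_left hmin h2.le]
  rw [hhigh z hsz]
  rcases le_or_gt z S with hzS | hSz
  · obtain ⟨hfin, hle⟩ := h.le_of_le hL hsz hzS h.finite_right
    refine ⟨hfin, ?_⟩
    nlinarith [mul_le_mul_of_nonneg_left hmin h2.le,
      mul_le_mul_of_nonneg_left hle (by linarith : 0 ≤ y - x)]
  · obtain ⟨hfin, hle⟩ := hL.chord hSz.le hzy.le (by linarith) h.finite_right hy
    refine ⟨hfin, ?_⟩
    have hSx : 0 ≤ S - x := by linarith [h.le]
    have hyS : 0 < y - S := by linarith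
    have key : (y - S) * (c * z + (L z).toReal)
        ≤ (y - z) * (c * S + (L S).toReal) + (z - S) * (c * y + (L y).toReal + K) := by
      linarith
    set GS := c * S + (L S).toReal with hGS
    set Gy := c * y + (L y).toReal with hGy
    -- The chord over `[S, y]` is compared with the one over `[x, y]`, after multiplication by `y -
    -- S`. The slack is exactly the sum of the nonnegative terms in `e3` and `e4`.
    have key2 : (y - S) * ((y - x) * (c * z + (L z).toReal))
        ≤ (y - S) * ((y - z) * (GS + K) + (z - x) * (Gy + K)) := by
      have e1 := mul_le_mul_of_nonneg_left key (by linarith : 0 ≤ y - x)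
      have e2 : (y - x) * ((y - z) * GS + (z - S) * (Gy + K))
          ≤ (y - S) * ((y - z) * (GS + K) + (z - x) * (Gy + K)) := by
        have e3 : 0 ≤ (y - z) * (S - x) * (Gy + K - GS) := by
          refine mul_nonneg (mul_nonneg h1.le hSx) ?_
          linarith [K.coe_nonneg]
        have e4 : 0 ≤ (y - S) * (y - z) * (K : ℝ) :=
          mul_nonneg (mul_nonneg hyS.le h1.le) K.coe_nonneg
        nlinarith
      linarith
    have key3 := le_of_mul_le_mul_left key2 hyS
    rw [hGS, hGy] at key3
    linarith

end IsOrderPair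

/-! ### Growth from the Veinott–Wagner condition -/

theorem VeinottWagner.exists_slope {c : ℝ} {h : ℝ → ℝ} (hVW : VeinottWagner c h)
    (hc : ConvexOn ℝ Set.univ h) : ∃ z k, c < k ∧ ∀ x < z, h z + k * (z - x) ≤ h x := by
  obtain ⟨z, y, hzy, hs⟩ := hVW
  refine ⟨z, -((h y - h z) / (y - z)), by linarith, fun x hx => ?_⟩
  have := hc.slope_mono_adjacent (Set.mem_univ x) (Set.mem_univ y) hx hzy
  rw [div_le_iff₀ (by linarith)] at this
  linarith

/-- On the left `h` grows at a rate `k > c` and beats the negative term `c y`; on the right both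
terms help. -/
theorem VeinottWagner.tendsto_add {c : ℝ} {h : ℝ → ℝ} (hVW : VeinottWagner c h) (hc0 : 0 ≤ c)
    (hc : ConvexOn ℝ Set.univ h) (hco : Tendsto h (cocompact ℝ) atTop) (m : ℝ) :
    Tendsto (fun y => c * y + h (y - m)) (cocompact ℝ) atTop := by
  rw [cocompact_eq_atBot_atTop, tendsto_sup] at hco ⊢
  constructor
  · obtain ⟨z, k, hk, hle⟩ := hVW.exists_slope hc
    have h1 : Tendsto (fun y : ℝ => (c - k) * y + (h z + k * (z + m))) atBot atTop :=
      tendsto_atTop_add_const_right _ _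
        (tendsto_id.const_mul_atBot_of_neg (by linarith))
    refine tendsto_atTop_mono' _ ?_ h1
    filter_upwards [eventually_lt_atBot (z + m)] with y hy
    linarith [hle (y - m) (by linarith)]
  · have h1 : Tendsto (fun y => h (y - m)) atTop atTop :=
      hco.2.comp (tendsto_atTop_add_const_right _ (-m) tendsto_id)
    refine tendsto_atTop_mono' _ ?_ h1
    filter_upwards [eventually_ge_atTop 0] with y hy
    linarith [mul_nonneg hc0 hy]

/-- A function that dominates one with the Veinott–Wagner condition satisfies this condition. -/
theorem VeinottWagner.of_le {c : ℝ} {h f : ℝ → ℝ} (hVW : VeinottWagner c h)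
    (hc : ConvexOn ℝ Set.univ h) (hf : ∀ x, h x ≤ f x) : VeinottWagner c f := by
  obtain ⟨z, k, hk, hle⟩ := hVW.exists_slope hc
  by_contra hcon
  unfold VeinottWagner at hcon
  push Not at hcon
  -- Were all slopes of `f` at least `-c`, then `f (z - u) ≤ f z + c u`, against `f (z - u) ≥ h z +
  -- k u` for large `u`.
  have h1 : Tendsto (fun u : ℝ => (k - c) * u) atTop atTop :=
    tendsto_id.const_mul_atTop (by linarith)
  obtain ⟨u, hu1, hu2⟩ :=
    ((h1.eventually_gt_atTop (f z - h z)).and (eventually_gt_atTop 0)).exists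
  have h2 := hcon (z - u) z (by linarith)
  have h3 := hle (z - u) (by linarith)
  rw [sub_sub_cancel, le_div_iff₀ hu2] at h2
  rw [sub_sub_cancel] at h3
  linarith [hf (z - u)]

/-! ### Transformed holding costs and variance decomposition -/

namespace GaussianInventory

variable (M : GaussianInventory)

/-- The standing assumptions on the holding cost and the discount factor. -/
structure IsRegular : Prop where
  discount : M.α < 1
  nonneg : ∀ x, 0 ≤ M.h x
  convex : ConvexOn ℝ Set.univ M.h
  coercive : Tendsto M.h (cocompact ℝ) atTop
  finite : ∀ (t : ℕ) (y : ℝ), ∫⁻ d, M.hStar t (y - d) ∂(M.demandStar t) < ∞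
  veinottWagner : VeinottWagner M.c M.h

variable {M}

theorem IsRegular.continuous (hM : M.IsRegular) : Continuous M.h :=
  continuousOn_univ.1 (hM.convex.continuousOn isOpen_univ)

theorem IsRegular.measurable (hM : M.IsRegular) : Measurable M.h := hM.continuous.measurable

theorem IsRegular.ofReal_midpoint (hM : M.IsRegular) (x u : ℝ) :
    2 * ENNReal.ofReal (M.h x) ≤ ENNReal.ofReal (M.h (x + u)) + ENNReal.ofReal (M.h (x - u)) := by
  have h := hM.convex.2 (Set.mem_univ (x + u)) (Set.mem_univ (x - u))
    (by norm_num : (0 : ℝ) ≤ 1 / 2) (by norm_num : (0 : ℝ) ≤ 1 / 2) (by norm_num)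
  simp only [smul_eq_mul] at h
  have e : 1 / 2 * (x + u) + 1 / 2 * (x - u) = x := by ring
  rw [e] at h
  rw [← ENNReal.ofReal_add (hM.nonneg _) (hM.nonneg _), ← ENNReal.ofReal_ofNat 2,
    ← ENNReal.ofReal_mul (by norm_num)]
  exact ENNReal.ofReal_le_ofReal (by linarith)

theorem IsRegular.measurable_hStar (hM : M.IsRegular) (t : ℕ) : Measurable (M.hStar t) := by
  have := hM.measurable
  unfold hStar
  refine Measurable.lintegral_prod_right'
    (f := fun p : ℝ × ℝ => ENNReal.ofReal (M.h (p.1 + p.2))) ?_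
  fun_prop

/-- Jensen bounds `h*_t` at `x` by its average over `x + D̄ - D*_t`, which is finite by assumption.
`h*_t` inherits midpoint convexity before it is known to be finite. -/
theorem IsRegular.hStar_lt_top (hM : M.IsRegular) (t : ℕ) (x : ℝ) : M.hStar t x < ∞ := by
  have hm := hM.measurable
  have hmid : ∀ x u, 2 * M.hStar t x ≤ M.hStar t (x + u) + M.hStar t (x - u) := by
    intro x u
    unfold hStar
    rw [← lintegral_const_mul _ (by fun_prop), ← lintegral_add_left (by fun_prop)]
    refine lintegral_mono fun z => ?_
    refine (hM.ofReal_midpoint (x + z) u).trans (le_of_eq ?_)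
    congr 3 <;> ring_nf
  have h := le_lintegral_gaussianReal_of_midpoint (hM.measurable_hStar t) hmid (x + M.meanD)
    M.meanD ((M.postVar t + M.varD) ^ 2 / (M.postVar t + M.varD + M.varEta))
  rw [add_sub_cancel_right] at h
  exact h.trans_lt (hM.finite t _)

theorem IsRegular.ofReal_le_hStar (hM : M.IsRegular) (t : ℕ) (x : ℝ) :
    ENNReal.ofReal (M.h x) ≤ M.hStar t x := by
  have hm := hM.measurable
  have h := le_lintegral_gaussianReal_of_midpoint (f := fun x => ENNReal.ofReal (M.h x))
    (by fun_prop) hM.ofReal_midpoint x 0 (M.postVar (t + 1))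
  have h2 := gaussianReal_map_neg (μ := 0) (v := M.postVar (t + 1))
  rw [neg_zero] at h2
  rw [sub_zero, ← h2, lintegral_map (by fun_prop) (by fun_prop)] at h
  simp only [sub_neg_eq_add] at h
  exact h

theorem IsRegular.veinottWagner_hStar (hM : M.IsRegular) (t : ℕ) :
    VeinottWagner M.c (fun x => (M.hStar t x).toReal) := by
  refine hM.veinottWagner.of_le hM.convex fun x => ?_
  have := ENNReal.toReal_mono (hM.hStar_lt_top t x).ne (hM.ofReal_le_hStar t x)
  rwa [ENNReal.toReal_ofReal (hM.nonneg x)] at this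

variable (M) in
/-- The expected holding cost in period `t` of the mean-belief problem, from the level `y` after
ordering. -/
def afterCost (t : ℕ) (y : ℝ) : ℝ≥0∞ := ∫⁻ d, M.hStar t (y - d) ∂(M.demandStar t)

theorem costStar_eq (t : ℕ) (x : ℝ) (a : ℝ≥0) :
    M.costStar t x a = M.orderCost a + M.afterCost t (x + a) := rfl

variable (M) in
-- The law of total variance for one observation.
theorem postVar_succ_add (t : ℕ) :
    ((M.postVar t + M.varD) ^ 2 / (M.postVar t + M.varD + M.varEta) : ℝ≥0) + M.postVar (t + 1)
      = M.postVar t + M.varD := by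
  change _ + (M.postVar t + M.varD) * M.varEta / (M.postVar t + M.varD + M.varEta) = _
  rw [← add_div, sq, ← mul_add]
  rcases eq_or_ne (M.postVar t + M.varD + M.varEta) 0 with h0 | h0
  · have : M.postVar t + M.varD = 0 := (add_eq_zero.1 h0).1
    simp [this]
  · exact mul_div_cancel_right₀ _ h0

/-- `D*_t - Z_t` is normal, and its variances add up to the full prior variance. The observation
noise therefore drops out of the expected holding cost. -/
theorem IsRegular.afterCost_eq (hM : M.IsRegular) (t : ℕ) (y : ℝ) :
    M.afterCost t y
      = ∫⁻ d, ENNReal.ofReal (M.h (y - d)) ∂(gaussianReal M.meanD (M.postVar t + M.varD)) := by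
  have hm := hM.measurable
  have h1 := lintegral_gaussianReal_affine M.meanD 0
    ((M.postVar t + M.varD) ^ 2 / (M.postVar t + M.varD + M.varEta)) (M.postVar (t + 1))
    1 (-1) 0 M.meanD (M.postVar t + M.varD) (by ring) (by
      have := congrArg NNReal.toReal (M.postVar_succ_add t)
      rw [NNReal.coe_add] at this
      linarith)
    (f := fun d => ENNReal.ofReal (M.h (y - d))) (by fun_prop)
  rw [← h1]
  unfold afterCost demandStar hStar
  refine lintegral_congr fun d => lintegral_congr fun z => ?_
  congr 2
  ring

theorem IsRegular.lintegral_cost (hM : M.IsRegular) (t : ℕ) (x : ℝ) (a : ℝ≥0) :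
    ∫⁻ ξ, M.cost ξ a ∂(gaussianReal x (M.postVar t)) = M.costStar t x a := by
  have hm := hM.measurable
  unfold cost
  rw [costStar_eq, hM.afterCost_eq, lintegral_add_left (by fun_prop)]
  congr 1
  · simp
  have h1 := lintegral_gaussianReal_affine x M.meanD (M.postVar t) M.varD
    1 (-1) a (x + a - M.meanD) (M.postVar t + M.varD) (by ring) (by push_cast; ring)
    (f := fun u => ENNReal.ofReal (M.h u)) (by fun_prop)
  have h2 := gaussianReal_map_const_sub (μ := M.meanD) (v := M.postVar t + M.varD) (x + a)
  rw [← h2, lintegral_map (by fun_prop) (by fun_prop)] at h1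
  rw [← h1]
  refine lintegral_congr fun ξ => lintegral_congr fun d => ?_
  congr 2
  ring

theorem IsRegular.afterCost_ne_top (hM : M.IsRegular) (t : ℕ) (y : ℝ) : M.afterCost t y ≠ ∞ :=
  (hM.finite t y).ne

theorem IsRegular.continuous_ofReal_h (hM : M.IsRegular) :
    Continuous fun x => ENNReal.ofReal (M.h x) := ENNReal.continuous_ofReal.comp hM.continuous

theorem IsRegular.lowerSemicontinuous_afterCost (hM : M.IsRegular) (t : ℕ) :
    LowerSemicontinuous (M.afterCost t) := by
  rw [funext (hM.afterCost_eq t)]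
  exact hM.continuous_ofReal_h.lowerSemicontinuous.lintegral_sub _

theorem IsRegular.kConvex_afterCost (hM : M.IsRegular) (t : ℕ) : KConvex 0 (M.afterCost t) := by
  rw [funext (hM.afterCost_eq t)]
  exact (KConvex.ofReal_of_convexOn hM.convex hM.nonneg).lintegral_sub
    hM.continuous_ofReal_h.measurable _

theorem IsRegular.continuous_afterCost (hM : M.IsRegular) (t : ℕ) :
    Continuous fun y => (M.afterCost t y).toReal :=
  continuousOn_univ.1 (((hM.kConvex_afterCost t).convexOn_toReal
    (hM.afterCost_ne_top t)).continuousOn isOpen_univ)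

theorem IsRegular.ofReal_le_afterCost (hM : M.IsRegular) (t : ℕ) (y : ℝ) :
    ENNReal.ofReal (M.h (y - M.meanD)) ≤ M.afterCost t y := by
  rw [hM.afterCost_eq]
  exact le_lintegral_gaussianReal_of_midpoint (f := fun x => ENNReal.ofReal (M.h x))
    hM.continuous_ofReal_h.measurable hM.ofReal_midpoint y _ _

/-! ### Dynamic programming for the mean-belief problem -/

variable (M) in
/-- The least expected cost from the level `x`, if the expected cost after ordering up to `y`
is `L y`. -/
def orderValue (L : ℝ → ℝ≥0∞) (x : ℝ) : ℝ≥0∞ := ⨅ a : ℝ≥0, (M.orderCost a + L (x + a))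

theorem orderCost_zero : M.orderCost 0 = 0 := by simp [orderCost]

theorem orderCost_of_pos {a : ℝ≥0} (ha : 0 < a) : M.orderCost a = M.K + M.c * a := by
  simp [orderCost, ha]

theorem orderCost_ssOrder_add_eq {L : ℝ → ℝ≥0∞} {s S : ℝ} (hsS : s ≤ S) (x : ℝ) :
    (M.orderCost (ssOrder s S x) : ℝ≥0∞) + L (x + ssOrder s S x)
      = orderPairValue M.K M.c L s S x := by
  unfold ssOrder orderPairValue
  split_ifs with hx
  · have hp : 0 < S - x := by linarith
    rw [orderCost_of_pos (Real.toNNReal_pos.2 hp), Real.coe_toNNReal _ hp.le,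
      add_sub_cancel, ENNReal.ofReal_add M.K.coe_nonneg (mul_nonneg M.c.coe_nonneg hp.le),
      ENNReal.ofReal_mul M.c.coe_nonneg, ENNReal.ofReal_coe_nnreal, ENNReal.ofReal_coe_nnreal,
      ENNReal.coe_add, ENNReal.coe_mul]
    rfl
  · simp [orderCost_zero]

/-- Below `s`, waiting costs more than ordering to the minimizer; from `s` on, no order recovers its
fixed cost, by `IsOrderPair.le_of_le`. -/
theorem orderValue_eq {L : ℝ → ℝ≥0∞} {s S : ℝ} (h : IsOrderPair M.K M.c L s S)
    (hL : KConvex M.K L) (x : ℝ) : M.orderValue L x = orderPairValue M.K M.c L s S x := by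
  refine le_antisymm ?_ (le_iInf fun a => ?_)
  · rw [← orderCost_ssOrder_add_eq h.le]
    exact iInf_le _ _
  rcases eq_or_ne (L (x + a)) ∞ with hLa | hLa
  · simp [hLa]
  have hfin : (M.orderCost a : ℝ≥0∞) + L (x + a) ≠ ∞ := by finiteness
  unfold orderPairValue
  rcases eq_zero_or_pos a with rfl | ha
  · simp only [NNReal.coe_zero, add_zero] at hLa hfin ⊢
    rw [orderCost_zero, ENNReal.coe_zero, zero_add]
    split_ifs with hx
    · have h3 : 0 ≤ M.K + M.c * (S - x) :=
        add_nonneg M.K.coe_nonneg (mul_nonneg M.c.coe_nonneg (by linarith [h.le]))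
      have h4 := h.finite_right
      rw [← ENNReal.toReal_le_toReal (by finiteness) hLa, ENNReal.toReal_add (by finiteness) h4,
        ENNReal.toReal_ofReal h3]
      linarith [h.lt_of_lt x hx hLa]
    · exact le_rfl
  · have hr : ((M.orderCost a : ℝ≥0∞) + L (x + a)).toReal
        = M.K + M.c * a + (L (x + a)).toReal := by
      rw [ENNReal.toReal_add (by finiteness) hLa, orderCost_of_pos ha, ENNReal.coe_toReal]
      simp
    split_ifs with hx
    · have h3 : 0 ≤ M.K + M.c * (S - x) :=
        add_nonneg M.K.coe_nonneg (mul_nonneg M.c.coe_nonneg (by linarith [h.le]))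
      have h4 := h.finite_right
      rw [← ENNReal.toReal_le_toReal (by finiteness) hfin, hr,
        ENNReal.toReal_add (by finiteness) h4, ENNReal.toReal_ofReal h3]
      linarith [h.min _ hLa]
    · obtain ⟨h1, h2⟩ := h.le_of_le hL (not_lt.1 hx) (le_add_of_nonneg_right a.coe_nonneg) hLa
      rw [← ENNReal.toReal_le_toReal h1 hfin, hr]
      linarith

variable (M) in
/-- The properties of value functions that are preserved by the dynamic programming recursion. -/
structure IsValue (v : ℝ → ℝ≥0∞) : Prop where
  lsc : LowerSemicontinuous v
  kConvex : KConvex M.K v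
  orderUp : ∀ x' x, x' ≤ x → v x' ≤ v x + M.K + ENNReal.ofReal (M.c * (x - x'))

theorem isValue_zero : M.IsValue (fun _ => 0) :=
  ⟨lowerSemicontinuous_const, KConvex.zero, fun _ _ _ => zero_le⟩

variable (M) in
/-- The expected cost after ordering up to `y` in period `t`, if the value of the next period
is `v`. -/
def afterValue (t : ℕ) (v : ℝ → ℝ≥0∞) (y : ℝ) : ℝ≥0∞ :=
  M.afterCost t y + M.α * ∫⁻ d, v (y - d) ∂(M.demandStar t)

theorem orderUp_orderValue (L : ℝ → ℝ≥0∞) (x' x : ℝ) (h : x' ≤ x) :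
    M.orderValue L x' ≤ M.orderValue L x + M.K + ENNReal.ofReal (M.c * (x - x')) := by
  unfold orderValue
  rw [add_assoc, ENNReal.iInf_add]
  refine le_iInf fun a => ?_
  -- From the lower level `x'`, the order is enlarged by `x - x'` to reach the same level as from
  -- `x`; at worst this adds a whole fixed cost.
  refine (iInf_le _ (a + (x - x').toNNReal)).trans ?_
  have e1 : x' + ((a + (x - x').toNNReal : ℝ≥0) : ℝ) = x + a := by
    rw [NNReal.coe_add, Real.coe_toNNReal _ (by linarith)]; ring
  have e2 : M.orderCost (a + (x - x').toNNReal)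
      ≤ M.orderCost a + (M.K + M.c * (x - x').toNNReal) := by
    unfold orderCost
    rw [mul_add]
    calc _ ≤ M.K + (M.c * a + M.c * (x - x').toNNReal) := by
          gcongr
          split_ifs
          exacts [le_rfl, zero_le]
      _ ≤ ((if 0 < a then M.K else 0) + M.K) + (M.c * a + M.c * (x - x').toNNReal) := by
          gcongr
          exact le_add_self
      _ = _ := by ring
  have e3 : (M.K : ℝ≥0∞) + ENNReal.ofReal (M.c * (x - x'))
      = ((M.K + M.c * (x - x').toNNReal : ℝ≥0) : ℝ≥0∞) := by
    rw [ENNReal.ofReal_mul M.c.coe_nonneg, ENNReal.ofReal_coe_nnreal]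
    rfl
  rw [e1, e3, add_right_comm, ← ENNReal.coe_add]
  gcongr

theorem IsRegular.exists_optimal_rule (hM : M.IsRegular) (t : ℕ) {v : ℝ → ℝ≥0∞}
    (hv : M.IsValue v) :
    M.IsValue (M.orderValue (M.afterValue t v)) ∧
    ∃ s S : ℝ, s ≤ S ∧ (0 < M.K → s < S) ∧ ∀ x, M.orderValue (M.afterValue t v) x
      = M.orderCost (ssOrder s S x) + M.afterValue t v (x + ssOrder s S x) := by
  set L := M.afterValue t v with hLdef
  have hαle : M.α ≤ 1 := hM.discount.le
  have hlsc : LowerSemicontinuous L :=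
    LowerSemicontinuous.add (hM.lowerSemicontinuous_afterCost t)
      ((ENNReal.continuous_const_mul ENNReal.coe_ne_top).comp_lowerSemicontinuous
        (hv.lsc.lintegral_sub _) (fun _ _ h => mul_le_mul_right h _))
  have hconv : KConvex M.K L := by
    refine ((hM.kConvex_afterCost t).add
      ((hv.kConvex.lintegral_sub hv.lsc.measurable (M.demandStar t)).const_mul M.α)).mono ?_
    rw [zero_add]
    exact mul_le_of_le_one_left zero_le hαle
  -- If `L` is infinite everywhere, all orders are equally bad and the levels `0 < 1` serve.
  by_cases hfin : ∃ y, L y ≠ ∞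
  · obtain ⟨y₀, hy₀⟩ := hfin
    obtain ⟨s, S, hsS⟩ := exists_isOrderPair (K := M.K) (c := M.c) hlsc
      (hM.veinottWagner.tendsto_add M.c.coe_nonneg hM.convex hM.coercive M.meanD)
      (fun y hy => by
        have h1 : ENNReal.ofReal (M.h (y - M.meanD)) ≤ L y :=
          (hM.ofReal_le_afterCost t y).trans le_self_add
        have h2 := ENNReal.toReal_mono hy h1
        rw [ENNReal.toReal_ofReal (hM.nonneg _)] at h2
        linarith) hy₀
    have hval := funext (orderValue_eq hsS hconv)
    refine ⟨⟨?_, ?_, orderUp_orderValue L⟩, s, S, hsS.le, fun hK => hsS.lt ?_, fun x => ?_⟩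
    · rw [hval]; exact hsS.lowerSemicontinuous_value hlsc
    · rw [hval]; exact hsS.kConvex_value hconv
    · have hLS := hsS.finite_right
      have hα1 : (M.α : ℝ) < 1 := by exact_mod_cast hM.discount
      have hK' : (0 : ℝ) < M.K := by exact_mod_cast hK
      -- Going from `S` down to `x` raises the discounted future cost by at most `α (K + c (S -
      -- x))`. The slack `(1 - α) K` covers the change of the continuous holding cost, so some `x <
      -- S` costs at most `K` above the minimum.
      have hlt : (M.afterCost t S).toReal < (M.afterCost t S).toReal + (1 - M.α) * M.K := by
        have := mul_pos (sub_pos.2 hα1) hK'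
        linarith
      have hev := ((hM.continuous_afterCost t).tendsto S).eventually_lt_const hlt
      have hev' : ∀ᶠ x in 𝓝[<] S, x < S := eventually_mem_nhdsWithin
      obtain ⟨x, hx1, hx2⟩ := ((hev.filter_mono nhdsWithin_le_nhds).and hev').exists
      set J := (M.α : ℝ≥0∞) * ∫⁻ d, v (S - d) ∂(M.demandStar t) with hJ
      have hJfin : J ≠ ∞ := ne_top_of_le_ne_top hLS le_add_self
      have hHx := hM.afterCost_ne_top t x
      have hHS := hM.afterCost_ne_top t S
      have hbound : L x ≤ M.afterCost t x
          + (J + M.α * (M.K + ENNReal.ofReal (M.c * (S - x)))) := by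
        refine add_le_add le_rfl ?_
        rw [hJ, ← mul_add]
        gcongr
        calc ∫⁻ d, v (x - d) ∂(M.demandStar t)
            ≤ ∫⁻ d, (v (S - d) + (M.K + ENNReal.ofReal (M.c * (S - x)))) ∂(M.demandStar t) := by
              refine lintegral_mono fun d => ?_
              have := hv.orderUp (x - d) (S - d) (by linarith)
              rwa [sub_sub_sub_cancel_right, add_assoc] at this
          _ = _ := by
              rw [lintegral_add_right _ measurable_const]
              simp
      have hbfin : M.afterCost t x
          + (J + M.α * (M.K + ENNReal.ofReal (M.c * (S - x)))) ≠ ∞ := by finiteness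
      refine ⟨x, hx2, ne_top_of_le_ne_top hbfin hbound, ?_⟩
      have hreal := ENNReal.toReal_mono hbfin hbound
      rw [ENNReal.toReal_add hHx (by finiteness), ENNReal.toReal_add hJfin (by finiteness),
        ENNReal.toReal_mul (a := (M.α : ℝ≥0∞)) (b := M.K + _),
        ENNReal.toReal_add (by finiteness) (by finiteness),
        ENNReal.toReal_ofReal (mul_nonneg M.c.coe_nonneg (by linarith)), ENNReal.coe_toReal,
        ENNReal.coe_toReal] at hreal
      have hLSr : (L S).toReal = (M.afterCost t S).toReal + J.toReal :=
        ENNReal.toReal_add hHS hJfin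
      have h5 : (M.α : ℝ) * (M.c * (S - x)) ≤ M.c * (S - x) :=
        mul_le_of_le_one_left (mul_nonneg M.c.coe_nonneg (by linarith)) hα1.le
      rw [hLSr]
      linarith
    · rw [orderValue_eq hsS hconv, orderCost_ssOrder_add_eq hsS.le]
  · push Not at hfin
    have hval : M.orderValue L = fun _ => ∞ := by
      funext x
      simp [orderValue, hfin]
    rw [hval]
    refine ⟨⟨lowerSemicontinuous_const, ?_, by simp⟩, 0, 1, zero_le_one, fun _ => zero_lt_one,
      fun x => by simp [hfin]⟩
    exact KConvex.of_chord fun x z y _ _ h => absurd rfl h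

variable (M) in
/-- The optimal expected cost from period `t` on in the mean-belief problem, if `n` periods
remain. -/
def valueStar : ℕ → ℕ → ℝ → ℝ≥0∞
  | 0, _ => fun _ => 0
  | n + 1, t => M.orderValue (M.afterValue t (valueStar n (t + 1)))

theorem IsRegular.isValue_valueStar (hM : M.IsRegular) (n t : ℕ) : M.IsValue (M.valueStar n t) := by
  induction n generalizing t with
  | zero => exact isValue_zero
  | succ n ih => exact (hM.exists_optimal_rule t (ih (t + 1))).1

end GaussianInventory

/-! ### Verification for controlled processes -/

namespace GaussianInventory

variable {M : GaussianInventory}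

theorem measurable_orderCost : Measurable M.orderCost := by
  unfold orderCost
  refine Measurable.add ?_ (by fun_prop)
  exact Measurable.ite measurableSet_Ioi measurable_const measurable_const

theorem IsRegular.measurable_afterCost (hM : M.IsRegular) (t : ℕ) : Measurable (M.afterCost t) :=
  (hM.lowerSemicontinuous_afterCost t).measurable

theorem IsRegular.measurable_costStar (hM : M.IsRegular) (t : ℕ) :
    Measurable fun q : ℝ × ℝ≥0 => M.costStar t q.1 q.2 := by
  have h1 := measurable_orderCost (M := M)
  have h2 := hM.measurable_afterCost t
  simp only [costStar_eq]
  fun_prop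

theorem IsRegular.measurable_valueStar (hM : M.IsRegular) (n t : ℕ) :
    Measurable (M.valueStar n t) :=
  (hM.isValue_valueStar n t).lsc.measurable

variable (M) in
/-- The process of levels `m t` and orders `a t` is controlled by the demands `D*_t`. -/
def IsControlled {Ω : Type*} [MeasurableSpace Ω] (μ : Measure Ω) (m : ℕ → Ω → ℝ)
    (a : ℕ → Ω → ℝ≥0) : Prop :=
  ∀ (t : ℕ) (f : ℝ → ℝ≥0∞), Measurable f →
    ∫⁻ ω, f (m (t + 1) ω) ∂μ = ∫⁻ ω, ∫⁻ d, f (m t ω + a t ω - d) ∂(M.demandStar t) ∂μ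

section

variable {Ω : Type*} [MeasurableSpace Ω] {μ : Measure Ω} {m : ℕ → Ω → ℝ} {a : ℕ → Ω → ℝ≥0}

theorem IsControlled.lintegral_step (hM : M.IsRegular) (hc : M.IsControlled μ m a)
    (hm : ∀ t, Measurable (m t)) (ha : ∀ t, Measurable (a t)) (n t : ℕ) :
    ∫⁻ ω, (M.orderCost (a t ω)
        + M.afterValue t (M.valueStar n (t + 1)) (m t ω + a t ω)) ∂μ
      = ∫⁻ ω, M.costStar t (m t ω) (a t ω) ∂μ
        + M.α * ∫⁻ ω, M.valueStar n (t + 1) (m (t + 1) ω) ∂μ := by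
  have hv := hM.measurable_valueStar n (t + 1)
  have hm' := hm t
  have ha' := ha t
  have h1 : Measurable fun ω => M.costStar t (m t ω) (a t ω) :=
    (hM.measurable_costStar t).comp (hm'.prodMk ha')
  have h2 : Measurable fun ω => ∫⁻ d, M.valueStar n (t + 1) (m t ω + a t ω - d)
      ∂(M.demandStar t) := by
    refine Measurable.lintegral_prod_right'
      (f := fun p : Ω × ℝ => M.valueStar n (t + 1) (m t p.1 + a t p.1 - p.2)) ?_
    fun_prop
  rw [hc t _ hv, ← lintegral_const_mul _ h2, ← lintegral_add_left h1]
  refine lintegral_congr fun ω => ?_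
  rw [costStar_eq, afterValue, add_assoc]

/-- The Bellman inequality, integrated and iterated. Only one-step laws of the levels enter, so it
applies to any policy in either problem. -/
theorem IsControlled.lintegral_valueStar_le (hM : M.IsRegular) (hc : M.IsControlled μ m a)
    (hm : ∀ t, Measurable (m t)) (ha : ∀ t, Measurable (a t)) (n t : ℕ) :
    ∫⁻ ω, M.valueStar n t (m t ω) ∂μ
      ≤ ∑ i ∈ Finset.range n, (M.α : ℝ≥0∞) ^ i
        * ∫⁻ ω, M.costStar (t + i) (m (t + i) ω) (a (t + i) ω) ∂μ := by
  induction n generalizing t with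
  | zero => simp [valueStar]
  | succ n ih =>
    calc ∫⁻ ω, M.valueStar (n + 1) t (m t ω) ∂μ
        ≤ ∫⁻ ω, (M.orderCost (a t ω)
            + M.afterValue t (M.valueStar n (t + 1)) (m t ω + a t ω)) ∂μ :=
          lintegral_mono fun ω => iInf_le _ (a t ω)
      _ = _ := hc.lintegral_step hM hm ha n t
      _ ≤ _ := by
          rw [Finset.sum_range_succ', add_comm]
          simp only [pow_zero, one_mul, add_zero]
          gcongr
          refine (mul_le_mul_right (ih (t + 1)) _).trans (le_of_eq ?_)
          rw [Finset.mul_sum]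
          refine Finset.sum_congr rfl fun i _ => ?_
          rw [pow_succ', mul_assoc, add_assoc, add_comm 1 i]

variable (M) in
/-- The `(s_t, S_t)` rules are optimal for the horizon `T`. -/
def IsOptimalRule (T : ℕ) (s S : ℕ → ℝ) : Prop :=
  ∀ n t, n + 1 + t = T → ∀ x, M.valueStar (n + 1) t x
    = M.orderCost (ssOrder (s t) (S t) x)
      + M.afterValue t (M.valueStar n (t + 1)) (x + ssOrder (s t) (S t) x)

theorem IsRegular.exists_isOptimalRule (hM : M.IsRegular) (T : ℕ) :
    ∃ s S : ℕ → ℝ, (∀ t, s t ≤ S t) ∧ (0 < M.K → ∀ t, s t < S t) ∧ M.IsOptimalRule T s S := by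
  choose s S h1 h2 h3 using fun n t =>
    (hM.exists_optimal_rule t (hM.isValue_valueStar n (t + 1))).2
  -- After period `t`, `T - 1 - t` periods remain. For `t ≥ T` the truncated difference is `0`, and
  -- the levels are still ordered correctly.
  refine ⟨fun t => s (T - 1 - t) t, fun t => S (T - 1 - t) t, fun t => h1 _ _,
    fun hK t => h2 _ _ hK, fun n t hnt x => ?_⟩
  obtain rfl : n = T - 1 - t := by omega
  exact h3 _ t x

/-- The orders follow the `(s_t, S_t)` rules. -/
def FollowsRule (μ : Measure Ω) (m : ℕ → Ω → ℝ) (a : ℕ → Ω → ℝ≥0) (s S : ℕ → ℝ) : Prop :=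
  ∀ (t : ℕ) (f : ℝ × ℝ≥0 → ℝ≥0∞), Measurable f →
    ∫⁻ ω, f (m t ω, a t ω) ∂μ = ∫⁻ ω, f (m t ω, ssOrder (s t) (S t) (m t ω)) ∂μ

theorem IsControlled.lintegral_valueStar_eq (hM : M.IsRegular) (hc : M.IsControlled μ m a)
    (hm : ∀ t, Measurable (m t)) (ha : ∀ t, Measurable (a t)) {s S : ℕ → ℝ}
    (hf : FollowsRule μ m a s S) {T : ℕ} (hs : M.IsOptimalRule T s S) (n t : ℕ) (hnt : n + t = T) :
    ∫⁻ ω, M.valueStar n t (m t ω) ∂μ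
      = ∑ i ∈ Finset.range n, (M.α : ℝ≥0∞) ^ i
        * ∫⁻ ω, M.costStar (t + i) (m (t + i) ω) (a (t + i) ω) ∂μ := by
  induction n generalizing t with
  | zero => simp [valueStar]
  | succ n ih =>
    have hmeas : Measurable fun q : ℝ × ℝ≥0 => (M.orderCost q.2 : ℝ≥0∞)
        + M.afterValue t (M.valueStar n (t + 1)) (q.1 + q.2) := by
      have h1 := measurable_orderCost (M := M)
      have h2 := hM.measurable_afterCost t
      have h3 := ((hM.isValue_valueStar n (t + 1)).lsc.lintegral_sub (M.demandStar t)).measurable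
      have h4 : Measurable (M.afterValue t (M.valueStar n (t + 1))) :=
        h2.add (measurable_const.mul h3)
      fun_prop
    calc ∫⁻ ω, M.valueStar (n + 1) t (m t ω) ∂μ
        = ∫⁻ ω, (M.orderCost (a t ω)
            + M.afterValue t (M.valueStar n (t + 1)) (m t ω + a t ω)) ∂μ := by
          rw [hf t _ hmeas]
          exact lintegral_congr fun ω => hs n t hnt _
      _ = _ := hc.lintegral_step hM hm ha n t
      _ = _ := by
          rw [Finset.sum_range_succ', add_comm]
          simp only [pow_zero, one_mul, add_zero]
          congr 1
          rw [ih (t + 1) (by omega), Finset.mul_sum]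
          refine Finset.sum_congr rfl fun i _ => ?_
          rw [pow_succ', mul_assoc, add_assoc, add_comm 1 i]

end
end GaussianInventory

/-! ### Trajectories -/

section Traj

variable {X : ℕ → Type*} [∀ n, MeasurableSpace (X n)] {μ₀ : Measure (X 0)}
  {κ : (n : ℕ) → Kernel (Π i : Finset.Iic n, X i) (X (n + 1))} [∀ n, IsMarkovKernel (κ n)]

theorem lintegral_trajMeasure_zero {f : X 0 → ℝ≥0∞} (hf : Measurable f) :
    ∫⁻ ω, f (ω 0) ∂(Kernel.trajMeasure μ₀ κ) = ∫⁻ x, f x ∂μ₀ := by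
  let e : X 0 → (Π i : Finset.Iic 0, X i) :=
    (MeasurableEquiv.piUnique (fun i : Finset.Iic 0 => X i)).symm
  have he : Measurable e := (MeasurableEquiv.piUnique (fun i : Finset.Iic 0 => X i)).symm.measurable
  have h : (Kernel.trajMeasure μ₀ κ).map (Preorder.frestrictLe 0) = μ₀.map e := by
    rw [Kernel.trajMeasure, Measure.map_comp _ _ (by fun_prop), Kernel.traj_map_frestrictLe,
      Kernel.partialTraj_self, Measure.id_comp]
    rfl
  have h2 := congrArg (fun ν => ∫⁻ p, f (p ⟨0, Finset.mem_Iic.2 le_rfl⟩) ∂ν) h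
  rw [lintegral_map (by fun_prop) (by fun_prop), lintegral_map (by fun_prop) he] at h2
  exact h2

theorem lintegral_trajMeasure_succ [IsProbabilityMeasure μ₀] (n : ℕ)
    {f : (Π i : Finset.Iic n, X i) × X (n + 1) → ℝ≥0∞} (hf : Measurable f) :
    ∫⁻ ω, f (Preorder.frestrictLe n ω, ω (n + 1)) ∂(Kernel.trajMeasure μ₀ κ)
      = ∫⁻ ω, ∫⁻ x, f (Preorder.frestrictLe n ω, x) ∂(κ n (Preorder.frestrictLe n ω))
        ∂(Kernel.trajMeasure μ₀ κ) := by
  have h := congrArg (fun ν => ∫⁻ p, f p ∂ν)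
    (Kernel.map_frestrictLe_trajMeasure_compProd_eq_map_trajMeasure (μ₀ := μ₀) (κ := κ) (a := n))
  rw [lintegral_map hf (by fun_prop), Measure.lintegral_compProd hf,
    lintegral_map (hf.lintegral_kernel_prod_right') (by fun_prop)] at h
  exact h.symm

end Traj

theorem inventoryKernel_apply (μ : Measure ℝ) [SFinite μ] (q : ℝ × ℝ≥0) :
    inventoryKernel μ q = μ.map (fun d => q.1 + q.2 - d) := by
  rw [inventoryKernel, Kernel.map_apply _ (by fun_prop), Kernel.prod_apply, Kernel.id_apply,
    Kernel.const_apply, Measure.dirac_prod, Measure.map_map (by fun_prop) (by fun_prop)]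
  rfl

theorem noiseKernel_apply (ν : Measure ℝ) [SFinite ν] (x : ℝ) :
    noiseKernel ν x = ν.map (fun e => x + e) := by
  rw [noiseKernel, Kernel.map_apply _ (by fun_prop), Kernel.prod_apply, Kernel.id_apply,
    Kernel.const_apply, Measure.dirac_prod, Measure.map_map (by fun_prop) (by fun_prop)]
  rfl

theorem noiseKernel_gaussianReal (v : ℝ≥0) (x : ℝ) :
    noiseKernel (gaussianReal 0 v) x = gaussianReal x v := by
  rw [noiseKernel_apply, gaussianReal_map_const_add, zero_add]

theorem lintegral_inventoryKernel (μ : Measure ℝ) [SFinite μ] (q : ℝ × ℝ≥0) {f : ℝ → ℝ≥0∞}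
    (hf : Measurable f) : ∫⁻ x, f x ∂(inventoryKernel μ q) = ∫⁻ d, f (q.1 + q.2 - d) ∂μ := by
  rw [inventoryKernel_apply, lintegral_map hf (by fun_prop)]

theorem lintegral_noiseKernel (ν : Measure ℝ) [SFinite ν] (x : ℝ) {f : ℝ → ℝ≥0∞}
    (hf : Measurable f) : ∫⁻ y, f y ∂(noiseKernel ν x) = ∫⁻ e, f (x + e) ∂ν := by
  rw [noiseKernel_apply, lintegral_map hf (by fun_prop)]

theorem Policy.ofFun_rule (φ : ∀ t : ℕ, Hist t → ℝ≥0) (hφ : ∀ t, Measurable (φ t)) (t : ℕ)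
    (p : Hist t) : (Policy.ofFun φ hφ).rule t p = Measure.dirac (φ t p) :=
  Kernel.deterministic_apply (hφ t) p

namespace GaussianInventory

variable {M : GaussianInventory}

/-! ### The mean-belief problem -/

instance (π : Policy) (x : ℝ) : IsProbabilityMeasure (M.lawStar π x) := by
  unfold lawStar; infer_instance

theorem lintegral_lawStar_zero (π : Policy) (x : ℝ) {f : ℝ × ℝ≥0 → ℝ≥0∞} (hf : Measurable f) :
    ∫⁻ ω, f (ω 0) ∂(M.lawStar π x)
      = ∫⁻ a, f (x, a) ∂(π.rule 0 ((Fin.elim0, x) : Hist 0)) := by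
  rw [lawStar, lintegral_trajMeasure_zero hf, initLawStar, Measure.lintegral_compProd hf,
    lintegral_dirac' _ (Measurable.lintegral_kernel_prod_right' hf)]
  rfl

theorem lintegral_lawStar_succ (π : Policy) (x : ℝ) (t : ℕ) {f : ℝ × ℝ≥0 → ℝ≥0∞}
    (hf : Measurable f) :
    ∫⁻ ω, f (ω (t + 1)) ∂(M.lawStar π x)
      = ∫⁻ ω, ∫⁻ d, ∫⁻ a, f ((ω t).1 + (ω t).2 - d, a)
          ∂(π.rule (t + 1) (nextHistStar t (Preorder.frestrictLe t ω, (ω t).1 + (ω t).2 - d)))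
          ∂(M.demandStar t) ∂(M.lawStar π x) := by
  rw [lawStar, lintegral_trajMeasure_succ (X := fun _ => ℝ × ℝ≥0) t
    (f := fun p => f p.2) (by fun_prop)]
  refine lintegral_congr fun ω => ?_
  rw [stepKernelStar, Kernel.lintegral_compProd _ _ _ hf, Kernel.comap_apply]
  have hm : Measurable fun q : ℝ => ∫⁻ a, f (q, a)
      ∂(π.rule (t + 1) (nextHistStar t (Preorder.frestrictLe t ω, q))) :=
    Measurable.lintegral_kernel_prod_right' (κ := (π.rule (t + 1)).comap
      (fun q => nextHistStar t (Preorder.frestrictLe t ω, q))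
      ((measurable_nextHistStar t).comp (by fun_prop))) hf
  exact lintegral_inventoryKernel _ _ hm

theorem isControlled_lawStar (π : Policy) (x : ℝ) :
    M.IsControlled (M.lawStar π x) (fun t ω => (ω t).1) (fun t ω => (ω t).2) := by
  intro t f hf
  have h := lintegral_lawStar_succ (M := M) π x t (f := fun q => f q.1) (by fun_prop)
  simpa using h

theorem followsRule_lawStar (s S : ℕ → ℝ) (x : ℝ) :
    FollowsRule (M.lawStar (ssPolicy s S) x) (fun t ω => (ω t).1) (fun t ω => (ω t).2) s S := by
  have key : ∀ (t : ℕ) (f : ℝ × ℝ≥0 → ℝ≥0∞), Measurable f → ∀ p : Hist t,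
      ∫⁻ a, f (p.2, a) ∂((ssPolicy s S).rule t p) = f (p.2, ssOrder (s t) (S t) p.2) := by
    intro t f hf p
    have h : (ssPolicy s S).rule t p = Measure.dirac (ssOrder (s t) (S t) p.2) :=
      Policy.ofFun_rule _ _ t p
    rw [h, lintegral_dirac' _ (by fun_prop)]
  intro t f hf
  have hs := measurable_ssOrder (s t) (S t)
  have hf' : Measurable fun q : ℝ × ℝ≥0 => f (q.1, ssOrder (s t) (S t) q.1) := by fun_prop
  cases t with
  | zero =>
    refine (lintegral_lawStar_zero _ _ hf).trans
      (Eq.trans ?_ (lintegral_lawStar_zero _ _ hf').symm)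
    simpa using key 0 f hf (Fin.elim0, x)
  | succ t =>
    refine (lintegral_lawStar_succ _ _ t hf).trans
      (Eq.trans ?_ (lintegral_lawStar_succ _ _ t hf').symm)
    refine lintegral_congr fun ω => lintegral_congr fun d => ?_
    simp only [lintegral_const, measure_univ, mul_one]
    exact key (t + 1) f hf (nextHistStar t (Preorder.frestrictLe t ω, (ω t).1 + (ω t).2 - d))

theorem totalCostStar_eq (hM : M.IsRegular) (T : ℕ) (π : Policy) (x : ℝ) :
    M.totalCostStar T π x = ∑ t ∈ Finset.range T, (M.α : ℝ≥0∞) ^ t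
      * ∫⁻ ω, M.costStar (0 + t) (ω (0 + t)).1 (ω (0 + t)).2 ∂(M.lawStar π x) := by
  have hm : ∀ t, Measurable fun ω : ℕ → ℝ × ℝ≥0 => M.costStar t (ω t).1 (ω t).2 :=
    fun t => (hM.measurable_costStar t).comp (measurable_pi_apply t)
  unfold totalCostStar
  rw [lintegral_finsetSum _ fun t _ => (hm t).const_mul _]
  refine Finset.sum_congr rfl fun t _ => ?_
  rw [lintegral_const_mul _ (hm t), zero_add]

theorem IsRegular.isOptimalStar (hM : M.IsRegular) {T : ℕ} {s S : ℕ → ℝ}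
    (hs : M.IsOptimalRule T s S) : M.IsOptimalStar T (ssPolicy s S) := by
  intro x
  have hm : ∀ t : ℕ, Measurable fun ω : ℕ → ℝ × ℝ≥0 => (ω t).1 := fun t => by fun_prop
  have ha : ∀ t : ℕ, Measurable fun ω : ℕ → ℝ × ℝ≥0 => (ω t).2 := fun t => by fun_prop
  -- The initial state does not depend on the policy, so the lower bound for `π` and the cost of the
  -- rule are the same number.
  have h0 : ∀ π : Policy, ∫⁻ ω, M.valueStar T 0 (ω 0).1 ∂(M.lawStar π x) = M.valueStar T 0 x := by
    intro π
    have hv := hM.measurable_valueStar T 0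
    rw [lintegral_lawStar_zero (f := fun q => M.valueStar T 0 q.1) _ _ (by fun_prop)]
    simp
  refine le_antisymm (le_iInf fun π => ?_) (iInf_le _ _)
  rw [totalCostStar_eq hM, totalCostStar_eq hM,
    ← (isControlled_lawStar (ssPolicy s S) x).lintegral_valueStar_eq hM hm ha
      (followsRule_lawStar s S x) hs T 0 rfl, h0, ← h0 π]
  exact (isControlled_lawStar π x).lintegral_valueStar_le hM hm ha T 0

end GaussianInventory

namespace GaussianInventory

variable {M : GaussianInventory}

/-! ### The filter of the partially observable problem -/

@[fun_prop]
theorem measurable_hist (t : ℕ) : Measurable (hist t) := by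
  unfold hist
  fun_prop

/-- The history of period `t` as a function of the trajectory up to this period. -/
def histOf (t : ℕ) (p : Finset.Iic t → (ℝ × ℝ) × ℝ≥0) : Hist t :=
  (fun i => ((p ⟨i, Finset.mem_Iic.2 i.2.le⟩).1.2, (p ⟨i, Finset.mem_Iic.2 i.2.le⟩).2),
    (p ⟨t, Finset.mem_Iic.2 le_rfl⟩).1.2)

@[fun_prop]
theorem measurable_histOf (t : ℕ) : Measurable (histOf t) := by
  unfold histOf
  fun_prop

/-- The history of period `t + 1`, from the history of period `t`, the order, and the next
observation. -/
def extHist (t : ℕ) (q : Hist t × ℝ≥0 × ℝ) : Hist (t + 1) :=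
  (Fin.snoc (α := fun _ => ℝ × ℝ≥0) q.1.1 (q.1.2, q.2.1), q.2.2)

@[fun_prop]
theorem measurable_extHist (t : ℕ) : Measurable (extHist t) := by
  refine Measurable.prodMk (measurable_pi_iff.2 fun i => ?_) (by fun_prop)
  induction i using Fin.lastCases with
  | last => simp only [Fin.snoc_last]; fun_prop
  | cast i => simp only [Fin.snoc_castSucc]; fun_prop

theorem hist_zero (ω : ℕ → (ℝ × ℝ) × ℝ≥0) : hist 0 ω = ((Fin.elim0, (ω 0).1.2) : Hist 0) :=
  Prod.ext (funext fun i => i.elim0) rfl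

theorem hist_succ (t : ℕ) (ω : ℕ → (ℝ × ℝ) × ℝ≥0) :
    hist (t + 1) ω = extHist t (hist t ω, (ω t).2, (ω (t + 1)).1.2) := by
  refine Prod.ext (funext fun i => ?_) rfl
  induction i using Fin.lastCases with
  | last => simp [hist, extHist]
  | cast i => simp [hist, extHist]

variable (M) in
/-- The mean of the inventory level of period `t + 1` before it is observed. -/
def priorMean (t : ℕ) (q : Hist t × ℝ≥0) : ℝ := M.postMean t q.1 + q.2 - M.meanD

variable (M) in
@[fun_prop]
theorem measurable_priorMean (t : ℕ) : Measurable (M.priorMean t) := by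
  have := M.measurable_postMean t
  unfold priorMean
  fun_prop

variable (M) in
theorem postMean_extHist (t : ℕ) (q : Hist t × ℝ≥0 × ℝ) :
    M.postMean (t + 1) (extHist t q) = M.priorMean t (q.1, q.2.1)
      + ((M.postVar t + M.varD : ℝ≥0) : ℝ) / ((M.postVar t + M.varD : ℝ≥0) + M.varEta)
        * (q.2.2 - M.priorMean t (q.1, q.2.1)) := by
  simp [postMean, extHist, priorMean]

theorem lintegral_law_zero (π : Policy) {f : (ℝ × ℝ) × ℝ≥0 → ℝ≥0∞} (hf : Measurable f) :
    ∫⁻ ω, f (ω 0) ∂(M.law π)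
      = ∫⁻ x, ∫⁻ e, ∫⁻ a, f ((x, x + e), a) ∂(π.rule 0 ((Fin.elim0, x + e) : Hist 0))
          ∂M.noise ∂(gaussianReal M.meanX M.varX) := by
  have hm : Measurable fun q : ℝ × ℝ => ∫⁻ a, f (q, a) ∂(π.rule 0 ((Fin.elim0, q.2) : Hist 0)) :=
    Measurable.lintegral_kernel_prod_right' (κ := (π.rule 0).comap
      (fun q : ℝ × ℝ => ((Fin.elim0, q.2) : Hist 0)) (by fun_prop)) hf
  rw [law, lintegral_trajMeasure_zero hf, initLaw, Measure.lintegral_compProd hf]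
  simp only [Kernel.comap_apply]
  rw [Measure.lintegral_compProd hm]
  exact lintegral_congr fun x => lintegral_noiseKernel _ _ (hm.comp measurable_prodMk_left)

theorem lintegral_law_succ (π : Policy) (t : ℕ)
    {f : (Finset.Iic t → (ℝ × ℝ) × ℝ≥0) × ((ℝ × ℝ) × ℝ≥0) → ℝ≥0∞} (hf : Measurable f) :
    ∫⁻ ω, f (Preorder.frestrictLe t ω, ω (t + 1)) ∂(M.law π)
      = ∫⁻ ω, ∫⁻ d, ∫⁻ e, ∫⁻ a,
          f (Preorder.frestrictLe t ω,
            (((ω t).1.1 + (ω t).2 - d, (ω t).1.1 + (ω t).2 - d + e), a))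
          ∂(π.rule (t + 1) (nextHist t (Preorder.frestrictLe t ω,
            ((ω t).1.1 + (ω t).2 - d, (ω t).1.1 + (ω t).2 - d + e))))
          ∂M.noise ∂M.demand ∂(M.law π) := by
  rw [law, lintegral_trajMeasure_succ (X := fun _ => (ℝ × ℝ) × ℝ≥0) t hf]
  refine lintegral_congr fun ω => ?_
  have hm : Measurable fun q : ℝ × ℝ => ∫⁻ a, f (Preorder.frestrictLe t ω, (q, a))
      ∂(π.rule (t + 1) (nextHist t (Preorder.frestrictLe t ω, q))) :=
    Measurable.lintegral_kernel_prod_right' (κ := (π.rule (t + 1)).comap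
      (fun q : ℝ × ℝ => nextHist t (Preorder.frestrictLe t ω, q))
      ((measurable_nextHist t).comp (by fun_prop)))
      (f := fun p => f (Preorder.frestrictLe t ω, p)) (by fun_prop)
  rw [stepKernel, Kernel.lintegral_compProd _ _ _ (by fun_prop), Kernel.comap_apply]
  simp only [Kernel.comap_apply]
  rw [Kernel.lintegral_compProd _ _ _ hm]
  simp only [Kernel.prodMkLeft_apply]
  have hm2 : Measurable fun x : ℝ => ∫⁻ y, ∫⁻ a, f (Preorder.frestrictLe t ω, ((x, y), a))
      ∂(π.rule (t + 1) (nextHist t (Preorder.frestrictLe t ω, (x, y)))) ∂(noiseKernel M.noise x) :=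
    Measurable.lintegral_kernel_prod_right' hm
  rw [lintegral_inventoryKernel _ _ hm2]
  exact lintegral_congr fun d => lintegral_noiseKernel _ _ (hm.comp measurable_prodMk_left)

/-- Given the history, the order is drawn from the decision rule, whatever the inventory level. -/
theorem lintegral_law_action (π : Policy) (t : ℕ) {g : (Hist t × ℝ) × ℝ≥0 → ℝ≥0∞}
    (hg : Measurable g) :
    ∫⁻ ω, g ((hist t ω, (ω t).1.1), (ω t).2) ∂(M.law π)
      = ∫⁻ ω, ∫⁻ a, g ((hist t ω, (ω t).1.1), a) ∂(π.rule t (hist t ω)) ∂(M.law π) := by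
  have hG : Measurable fun p : Hist t × ℝ => ∫⁻ a, g (p, a) ∂(π.rule t p.1) :=
    Measurable.lintegral_kernel_prod_right' (κ := (π.rule t).comap Prod.fst measurable_fst) hg
  cases t with
  | zero =>
    simp only [hist_zero]
    refine (lintegral_law_zero (M := M) π
      (f := fun q => g ((((Fin.elim0, q.1.2) : Hist 0), q.1.1), q.2)) (by fun_prop)).trans ?_
    refine Eq.trans ?_ (lintegral_law_zero (M := M) π
      (f := fun q => ∫⁻ a, g ((((Fin.elim0, q.1.2) : Hist 0), q.1.1), a)
        ∂(π.rule 0 ((Fin.elim0, q.1.2) : Hist 0)))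
      (hG.comp (f := fun q : (ℝ × ℝ) × ℝ≥0 => (((Fin.elim0, q.1.2) : Hist 0), q.1.1))
        (by fun_prop))).symm
    simp
  | succ t =>
    have hn := measurable_nextHist t
    refine (lintegral_law_succ (M := M) π t
      (f := fun q => g ((nextHist t (q.1, q.2.1), q.2.1.1), q.2.2)) (by fun_prop)).trans ?_
    refine Eq.trans ?_ (lintegral_law_succ (M := M) π t
      (f := fun q => ∫⁻ a, g ((nextHist t (q.1, q.2.1), q.2.1.1), a)
        ∂(π.rule (t + 1) (nextHist t (q.1, q.2.1))))
      (hG.comp (f := fun q : (Finset.Iic t → (ℝ × ℝ) × ℝ≥0) × ((ℝ × ℝ) × ℝ≥0) =>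
        (nextHist t (q.1, q.2.1), q.2.1.1)) (by fun_prop))).symm
    simp

theorem lintegral_law_next (π : Policy) (t : ℕ) {g : (Hist t × ℝ≥0) × (ℝ × ℝ) → ℝ≥0∞}
    (hg : Measurable g) :
    ∫⁻ ω, g ((hist t ω, (ω t).2), ((ω (t + 1)).1.2, (ω (t + 1)).1.1)) ∂(M.law π)
      = ∫⁻ ω, ∫⁻ d, ∫⁻ e, g ((hist t ω, (ω t).2),
          ((ω t).1.1 + (ω t).2 - d + e, (ω t).1.1 + (ω t).2 - d))
          ∂M.noise ∂M.demand ∂(M.law π) := by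
  refine (lintegral_law_succ (M := M) π t
    (f := fun q => g ((histOf t q.1, (q.1 ⟨t, Finset.mem_Iic.2 le_rfl⟩).2), (q.2.1.2, q.2.1.1)))
    (by fun_prop)).trans ?_
  refine lintegral_congr fun ω => lintegral_congr fun d => lintegral_congr fun e => ?_
  simp only [lintegral_const, measure_univ, mul_one]
  rfl

variable (M) in
/-- The posterior law of the inventory level. -/
def posterior (t : ℕ) : Kernel (Hist t) ℝ :=
  (noiseKernel (gaussianReal 0 (M.postVar t))).comap (M.postMean t) (M.measurable_postMean t)

instance (t : ℕ) : IsMarkovKernel (M.posterior t) := by unfold posterior; infer_instance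

theorem posterior_apply (t : ℕ) (p : Hist t) :
    M.posterior t p = gaussianReal (M.postMean t p) (M.postVar t) := by
  rw [posterior, Kernel.comap_apply, noiseKernel_gaussianReal]

variable (M) in
/-- The inventory level of period `t` has the conditional law `posterior` given the history. -/
def IsFiltered (π : Policy) (t : ℕ) : Prop :=
  ∀ g : Hist t × ℝ → ℝ≥0∞, Measurable g →
    ∫⁻ ω, g (hist t ω, (ω t).1.1) ∂(M.law π)
      = ∫⁻ ω, ∫⁻ ξ, g (hist t ω, ξ) ∂(M.posterior t (hist t ω)) ∂(M.law π)

/-- Given the history, order and inventory level are independent. -/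
theorem IsFiltered.lintegral_action {π : Policy} {t : ℕ} (h : M.IsFiltered π t)
    {g : (Hist t × ℝ) × ℝ≥0 → ℝ≥0∞} (hg : Measurable g) :
    ∫⁻ ω, g ((hist t ω, (ω t).1.1), (ω t).2) ∂(M.law π)
      = ∫⁻ ω, ∫⁻ ξ, g ((hist t ω, ξ), (ω t).2) ∂(M.posterior t (hist t ω)) ∂(M.law π) := by
  have h1 : Measurable fun p : Hist t × ℝ => ∫⁻ a, g (p, a) ∂(π.rule t p.1) :=
    Measurable.lintegral_kernel_prod_right' (κ := (π.rule t).comap Prod.fst measurable_fst) hg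
  have h2 : Measurable fun p : (Hist t × ℝ) × ℝ≥0 =>
      ∫⁻ ξ, g ((p.1.1, ξ), p.2) ∂(M.posterior t p.1.1) :=
    Measurable.lintegral_kernel_prod_right' (κ := (M.posterior t).comap
      (fun p : (Hist t × ℝ) × ℝ≥0 => p.1.1) (by fun_prop))
      (f := fun q => g ((q.1.1.1, q.2), q.1.2)) (by fun_prop)
  rw [lintegral_law_action π t hg, h _ h1]
  refine Eq.trans ?_ (lintegral_law_action π t h2).symm
  refine lintegral_congr fun ω => ?_
  -- With the history fixed, the rule ignores the hidden level, so order and level can be drawn in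
  -- either sequence.
  exact lintegral_lintegral_swap (μ := M.posterior t (hist t ω)) (ν := π.rule t (hist t ω))
    (f := fun ξ a => g ((hist t ω, ξ), a)) (by unfold Function.uncurry; fun_prop)

/-- The joint law of the next observation and the next inventory level. -/
theorem IsFiltered.lintegral_next {π : Policy} {t : ℕ} (h : M.IsFiltered π t)
    {g : (Hist t × ℝ≥0) × (ℝ × ℝ) → ℝ≥0∞} (hg : Measurable g) :
    ∫⁻ ω, g ((hist t ω, (ω t).2), ((ω (t + 1)).1.2, (ω (t + 1)).1.1)) ∂(M.law π)
      = ∫⁻ ω, ∫⁻ y, ∫⁻ w, g ((hist t ω, (ω t).2), (y, w))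
          ∂(M.posterior (t + 1) (extHist t (hist t ω, (ω t).2, y)))
          ∂(gaussianReal (M.priorMean t (hist t ω, (ω t).2)) (M.postVar t + M.varD + M.varEta))
          ∂(M.law π) := by
  rw [lintegral_law_next π t hg]
  have hm : Measurable fun p : (Hist t × ℝ) × ℝ≥0 => ∫⁻ d, ∫⁻ e, g ((p.1.1, p.2),
      (p.1.2 + p.2 - d + e, p.1.2 + p.2 - d)) ∂M.noise ∂M.demand := by
    refine Measurable.lintegral_prod_right' (f := fun q : ((Hist t × ℝ) × ℝ≥0) × ℝ =>
      ∫⁻ e, g ((q.1.1.1, q.1.2),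
        (q.1.1.2 + q.1.2 - q.2 + e, q.1.1.2 + q.1.2 - q.2)) ∂M.noise) ?_
    refine Measurable.lintegral_prod_right' (f := fun q : (((Hist t × ℝ) × ℝ≥0) × ℝ) × ℝ =>
      g ((q.1.1.1.1, q.1.1.2), (q.1.1.1.2 + q.1.1.2 - q.1.2 + q.2,
        q.1.1.1.2 + q.1.1.2 - q.1.2))) ?_
    fun_prop
  refine (h.lintegral_action hm).trans ?_
  refine lintegral_congr fun ω => ?_
  rw [posterior_apply]
  have hm1 : Measurable fun w => ∫⁻ e, g ((hist t ω, (ω t).2), (w + e, w)) ∂M.noise := by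
    refine Measurable.lintegral_prod_right' (f := fun q : ℝ × ℝ =>
      g ((hist t ω, (ω t).2), (q.1 + q.2, q.1))) ?_
    fun_prop
  -- Prediction, then correction: `ξ - D + a` has the prior normal law, and `e2` conditions it on
  -- the noisy observation.
  have e1 := lintegral_gaussianReal_affine (M.postMean t (hist t ω)) M.meanD (M.postVar t) M.varD
    1 (-1) (ω t).2 (M.priorMean t (hist t ω, (ω t).2)) (M.postVar t + M.varD)
    (by unfold priorMean; ring) (by push_cast; ring) hm1
  have e2 := lintegral_gaussianReal_posterior (M.priorMean t (hist t ω, (ω t).2))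
    (M.postVar t + M.varD) M.varEta (f := fun y w => g ((hist t ω, (ω t).2), (y, w)))
    (by unfold Function.uncurry; fun_prop)
  refine Eq.trans ?_ ((e1.trans e2).trans ?_)
  · refine lintegral_congr fun ξ => lintegral_congr fun d => ?_
    have : 1 * ξ + -1 * d + ((ω t).2 : ℝ) = ξ + (ω t).2 - d := by ring
    rw [this]
  · refine lintegral_congr fun y => ?_
    rw [posterior_apply, postMean_extHist]
    rfl

variable (M) in
-- Induction on the period. Both sides are integrated over the same law of history and observation,
-- and on the right the average over the hidden level is of a constant.
theorem isFiltered (π : Policy) (t : ℕ) : M.IsFiltered π t := by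
  have hP : ∀ (t : ℕ) (g : Hist t × ℝ → ℝ≥0∞), Measurable g →
      Measurable fun p : Hist t => ∫⁻ ξ, g (p, ξ) ∂(M.posterior t p) :=
    fun t g hg => Measurable.lintegral_kernel_prod_right' hg
  induction t with
  | zero =>
    intro g hg
    have hg' := hP 0 g hg
    simp only [hist_zero]
    refine (lintegral_law_zero (M := M) π
      (f := fun q => g (((Fin.elim0, q.1.2) : Hist 0), q.1.1)) (by fun_prop)).trans ?_
    refine Eq.trans ?_ (lintegral_law_zero (M := M) π
      (f := fun q => ∫⁻ ξ, g (((Fin.elim0, q.1.2) : Hist 0), ξ)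
        ∂(M.posterior 0 ((Fin.elim0, q.1.2) : Hist 0)))
      (hg'.comp (f := fun q : (ℝ × ℝ) × ℝ≥0 => ((Fin.elim0, q.1.2) : Hist 0))
        (by fun_prop))).symm
    simp only [lintegral_const, measure_univ, mul_one]
    have e1 := lintegral_gaussianReal_posterior M.meanX M.varX M.varEta
      (f := fun y w => g (((Fin.elim0, y) : Hist 0), w)) (by unfold Function.uncurry; fun_prop)
    have e2 := lintegral_gaussianReal_posterior M.meanX M.varX M.varEta
      (f := fun y _ => ∫⁻ ξ, g (((Fin.elim0, y) : Hist 0), ξ)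
        ∂(M.posterior 0 ((Fin.elim0, y) : Hist 0)))
      (hg'.comp (f := fun q : ℝ × ℝ => ((Fin.elim0, q.1) : Hist 0)) (by fun_prop))
    refine e1.trans (Eq.trans ?_ e2.symm)
    refine lintegral_congr fun y => ?_
    simp only [lintegral_const, measure_univ, mul_one]
    rw [posterior_apply]
    rfl
  | succ t ih =>
    intro g hg
    have hg' := hP (t + 1) g hg
    simp only [hist_succ]
    have h1 := ih.lintegral_next
      (g := fun q => g (extHist t (q.1.1, q.1.2, q.2.1), q.2.2)) (by fun_prop)
    have h2 := ih.lintegral_next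
      (g := fun q => ∫⁻ ξ, g (extHist t (q.1.1, q.1.2, q.2.1), ξ)
        ∂(M.posterior (t + 1) (extHist t (q.1.1, q.1.2, q.2.1))))
      (hg'.comp (f := fun q : (Hist t × ℝ≥0) × (ℝ × ℝ) => extHist t (q.1.1, q.1.2, q.2.1))
        (by fun_prop))
    refine h1.trans (Eq.trans ?_ h2.symm)
    refine lintegral_congr fun ω => lintegral_congr fun y => ?_
    simp

variable (M) in
theorem condDistrib_eq (π : Policy) (t : ℕ) :
    ∀ᵐ p ∂((M.law π).map (hist t)),
      condDistrib (fun ω : ℕ → (ℝ × ℝ) × ℝ≥0 => (ω t).1.1) (hist t) (M.law π) p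
        = gaussianReal (M.postMean t p) (M.postVar t) := by
  have h : condDistrib (fun ω : ℕ → (ℝ × ℝ) × ℝ≥0 => (ω t).1.1) (hist t) (M.law π)
      =ᵐ[(M.law π).map (hist t)] M.posterior t := by
    refine condDistrib_ae_eq_of_measure_eq_compProd_of_measurable (by fun_prop) (by fun_prop) ?_
    refine Measure.ext_of_lintegral _ fun g hg => ?_
    rw [lintegral_map hg (by fun_prop), Measure.lintegral_compProd hg,
      lintegral_map hg.lintegral_kernel_prod_right' (by fun_prop)]
    exact M.isFiltered π t g hg
  filter_upwards [h] with p hp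
  rw [hp, posterior_apply]

/-! ### Reduction of the partially observable problem to mean beliefs -/

theorem isControlled_law (π : Policy) :
    M.IsControlled (M.law π) (fun t ω => M.postMean t (hist t ω)) (fun t ω => (ω t).2) := by
  intro t f hf
  have hp := M.measurable_postMean (t + 1)
  simp only [hist_succ]
  have h := (M.isFiltered π t).lintegral_next
    (g := fun q => f (M.postMean (t + 1) (extHist t (q.1.1, q.1.2, q.2.1)))) (by fun_prop)
  refine h.trans (lintegral_congr fun ω => ?_)
  simp only [lintegral_const, measure_univ, mul_one, postMean_extHist]
  set m := M.priorMean t (hist t ω, (ω t).2) with hm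
  set V := M.postVar t + M.varD
  set r := M.varEta
  -- The innovation `y - m` has variance `V + r`; multiplied by the gain `V / (V + r)` it has the
  -- variance of `D*_t`. The second normal variable in `e1` and the first in the product order of
  -- `e2` may be ignored where their coefficients are `0`.
  have e1 := lintegral_gaussianReal_affine m 0 (V + r) 0 ((V : ℝ) / (V + r)) 0
    (m - (V : ℝ) / (V + r) * m) m (V ^ 2 / (V + r)) (by ring) (by
      push_cast
      rcases eq_or_ne ((V : ℝ) + r) 0 with h0 | h0
      · simp [h0]
      · field_simp; ring) hf
  have e2 := lintegral_gaussianReal_affine M.meanD 0 (V ^ 2 / (V + r)) 0 (-1) 0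
    (m + M.meanD) m (V ^ 2 / (V + r)) (by ring) (by push_cast; ring) hf
  simp only [lintegral_const, measure_univ, mul_one, zero_mul, add_zero] at e1 e2
  refine Eq.trans ?_ ((e1.trans e2.symm).trans ?_)
  · refine lintegral_congr fun y => ?_
    congr 1; ring
  · refine lintegral_congr fun d => ?_
    congr 1
    simp only [hm, priorMean]
    ring

theorem followsRule_law (s S : ℕ → ℝ) :
    FollowsRule (M.law (M.ssBeliefPolicy s S)) (fun t ω => M.postMean t (hist t ω))
      (fun t ω => (ω t).2) s S := by
  intro t f hf
  have hp := M.measurable_postMean t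
  refine (lintegral_law_action _ t (g := fun q => f (M.postMean t q.1.1, q.2))
    (by fun_prop)).trans (lintegral_congr fun ω => ?_)
  have h : (M.ssBeliefPolicy s S).rule t (hist t ω)
      = Measure.dirac (ssOrder (s t) (S t) (M.postMean t (hist t ω))) :=
    Policy.ofFun_rule _ _ t (hist t ω)
  rw [h, lintegral_dirac' _ (by fun_prop)]

theorem IsRegular.measurable_cost (hM : M.IsRegular) :
    Measurable fun q : ℝ × ℝ≥0 => M.cost q.1 q.2 := by
  have h1 := measurable_orderCost (M := M)
  have h2 := hM.measurable
  unfold cost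
  refine Measurable.add (h1.comp measurable_snd).coe_nnreal_ennreal ?_
  refine Measurable.lintegral_prod_right'
    (f := fun p : (ℝ × ℝ≥0) × ℝ => ENNReal.ofReal (M.h (p.1.1 + p.1.2 - p.2))) ?_
  fun_prop

/-- Given history and order the level still has its posterior law, so the hidden cost averages to
`c*_t` at the posterior mean. -/
theorem totalCost_eq (hM : M.IsRegular) (T : ℕ) (π : Policy) :
    M.totalCost T π = ∑ t ∈ Finset.range T, (M.α : ℝ≥0∞) ^ t
      * ∫⁻ ω, M.costStar (0 + t) (M.postMean (0 + t) (hist (0 + t) ω)) (ω (0 + t)).2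
        ∂(M.law π) := by
  have hc := hM.measurable_cost
  have hm : ∀ t, Measurable fun ω : ℕ → (ℝ × ℝ) × ℝ≥0 => M.cost (ω t).1.1 (ω t).2 :=
    fun t => hc.comp (f := fun ω : ℕ → (ℝ × ℝ) × ℝ≥0 => ((ω t).1.1, (ω t).2)) (by fun_prop)
  unfold totalCost
  rw [lintegral_finsetSum _ fun t _ => (hm t).const_mul _]
  refine Finset.sum_congr rfl fun t _ => ?_
  rw [lintegral_const_mul _ (hm t), zero_add]
  congr 1
  refine ((M.isFiltered π t).lintegral_action
    (g := fun q => M.cost q.1.2 q.2)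
    (hc.comp (f := fun q : (Hist t × ℝ) × ℝ≥0 => (q.1.2, q.2)) (by fun_prop))).trans ?_
  refine lintegral_congr fun ω => ?_
  rw [posterior_apply, hM.lintegral_cost]

theorem IsRegular.isOptimal (hM : M.IsRegular) {T : ℕ} {s S : ℕ → ℝ}
    (hs : M.IsOptimalRule T s S) : M.IsOptimal T (M.ssBeliefPolicy s S) := by
  have hm : ∀ t : ℕ, Measurable fun ω : ℕ → (ℝ × ℝ) × ℝ≥0 => M.postMean t (hist t ω) :=
    fun t => (M.measurable_postMean t).comp (measurable_hist t)
  have ha : ∀ t : ℕ, Measurable fun ω : ℕ → (ℝ × ℝ) × ℝ≥0 => (ω t).2 := fun t => by fun_prop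
  -- The first observation precedes all orders, so the law of the initial posterior mean is common
  -- to all policies.
  have h0 : ∀ π : Policy, ∫⁻ ω, M.valueStar T 0 (M.postMean 0 (hist 0 ω)) ∂(M.law π)
      = ∫⁻ x, ∫⁻ e, M.valueStar T 0 (M.postMean 0 ((Fin.elim0, x + e) : Hist 0))
        ∂M.noise ∂(gaussianReal M.meanX M.varX) := by
    intro π
    have hv := hM.measurable_valueStar T 0
    have hp := M.measurable_postMean 0
    have h := lintegral_law_zero (M := M) π
      (f := fun q => M.valueStar T 0 (M.postMean 0 ((Fin.elim0, q.1.2) : Hist 0))) (by fun_prop)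
    simpa [hist_zero] using h
  refine le_antisymm (le_iInf fun π => ?_) (iInf_le _ _)
  rw [totalCost_eq hM, totalCost_eq hM,
    ← (isControlled_law (M.ssBeliefPolicy s S)).lintegral_valueStar_eq hM hm ha
      (followsRule_law s S) hs T 0 rfl, h0, ← h0 π]
  exact (isControlled_law π).lintegral_valueStar_le hM hm ha T 0

end GaussianInventory

end

theorem mainTheorem2 (M : GaussianInventory) (hα : M.α < 1)
    (h_nonneg : ∀ x, 0 ≤ M.h x) (h_convex : ConvexOn ℝ Set.univ M.h)
    (h_coercive : Tendsto M.h (cocompact ℝ) atTop)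
    (h_finite : ∀ (t : ℕ) (y : ℝ), ∫⁻ d, M.hStar t (y - d) ∂(M.demandStar t) < ∞)
    (h_VW : VeinottWagner M.c M.h) :
    -- the transformed holding costs are finite and satisfy the Veinott–Wagner condition
    (∀ t : ℕ, (∀ x, M.hStar t x < ∞) ∧ VeinottWagner M.c (fun x => (M.hStar t x).toReal)) ∧
    -- given the history, the inventory level is normal with mean `postMean` and variance `postVar`
    (∀ (π : Policy) (t : ℕ),
      ∀ᵐ p ∂((M.law π).map (GaussianInventory.hist t)),
        condDistrib (fun ω : ℕ → (ℝ × ℝ) × ℝ≥0 => (ω t).1.1) (GaussianInventory.hist t) (M.law π) p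
          = gaussianReal (M.postMean t p) (M.postVar t)) ∧
    -- the costs of the problem for mean beliefs are the expected costs under the belief
    (∀ (t : ℕ) (x : ℝ) (a : ℝ≥0),
      ∫⁻ ξ, M.cost ξ a ∂(gaussianReal x (M.postVar t)) = M.costStar t x a) ∧
    -- for every horizon, one `(s_t, S_t)`-policy is optimal in both problems
    ∀ T : ℕ, ∃ s S : ℕ → ℝ,
      (∀ t, s t ≤ S t) ∧ (0 < M.K → ∀ t, s t < S t) ∧
      M.IsOptimalStar T (GaussianInventory.ssPolicy s S) ∧
      M.IsOptimal T (M.ssBeliefPolicy s S) := by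
  have hM : M.IsRegular := ⟨hα, h_nonneg, h_convex, h_coercive, h_finite, h_VW⟩
  refine ⟨fun t => ⟨hM.hStar_lt_top t, hM.veinottWagner_hStar t⟩, M.condDistrib_eq,
    hM.lintegral_cost, fun T => ?_⟩
  obtain ⟨s, S, h1, h2, hs⟩ := hM.exists_isOptimalRule T
  exact ⟨s, S, h1, h2, hM.isOptimalStar hs, hM.isOptimal hs⟩
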